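/- Let $\rho$ be a probability measure on $\mathcal X\times\mathcal Y$ (measurable spaces), let $\Phi:\mathcal X\to\mathcal F$ be a measurable map into a real separable Hilbert space, and let $\ell:\mathcal Y\times\mathbb R\to[0,\infty)$ be a measurable loss that is convex in its second entry, with left-hand derivative $\ell'_-(y,\cdot)$. For $w\in\mathcal F$ put $\mathcal E(w)=\int \ell(y,\langle w,\Phi(x)\rangle)\,d\rho(x,y)$. Assume: 1. (Boundedness) $\kappa:=\sup_{x}\sqrt{\langle\Phi(x),\Phi(x)\rangle}<\infty$, $\sup_{y}\ell(y,0)<\infty$, and $|\ell'_-(y,a)|\le a_0$ for all $y\in\mathcal Y$, $a\in\mathbb R$. 2. (Approximation error) For some $\beta\in(0,1]$ and $c_\beta>0$, $$\mathcal D(\lambda):=\inf_{w\in\mathcal F}\Big\{\mathcal E(w)+\tfrac{\lambda}{2}\|w\|^2\Big\}-\inf_{w\in\mathcal F}\mathcal E(w)\le c_\beta\lambda^\beta\qquad\text{for all }\lambda>0.$$ 3. (Smoothness) For all $y$, $\ell(y,\cdot)$ is differentiable and $|\ell'(y,b)-\ell'(y,a)|\le L|b-a|$ for all $a,b\in\mathbb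 R$, with a constant $L>0$. Let $(\eta_t)_{t\ge1}$ be a non-increasing sequence of positive step-sizes with $\eta_t\le 2/(\kappa^2L)$ for all $t\ge1$ (no restriction if $\kappa=0$). Given $n\ge1$, let $S=\{(x_i,y_i)\}_{i=1}^n$ be i.i.d. from $\rho$ and let $j_1,j_2,\dots$ be i.i.d. uniform on $\{1,\dots,n\}$, independent of $S$. The stochastic gradient iterates are $w_1=0$ and $$w_{t+1}=w_t-\eta_t\,\ell'_-(y_{j_t},\langle w_t,\Phi(x_{j_t})\rangle)\,\Phi(x_{j_t}),\qquad t\ge1,$$ and the averaged iterates are $\overline w_t=\sum_{k=1}^t\eta_kw_k\big/\sum_{k=1}^t\eta_k$. Then there is a constant $C>0$, depending only on $\kappa$, $a_0$ and $c_\beta$, such that for all $n\ge1$ and all $t\ge1$ the excess risks below are integrable and $$\mathbb E\Big[\mathcal E(\overline w_t)-\inf_{w\in\mathcal F}\mathcal E(w)\Big]\le C\left(\frac{\sum_{k=1}^t\eta_k}{n}+\frac{\sum_{k=1}^t\eta_k^2}{\sum_{k=1}^t\eta_k}+\Big(\frac1{\sum_{k=1}^t\eta_k}\Big)^{\beta}\right)$$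 and $$\mathbb E\Big[\mathcal E(w_t)-\inf_{w\in\mathcal F}\mathcal E(w)\Big]\le C\left(\frac{\sum_{k=1}^t\eta_k}{n}\sum_{k=1}^{t-1}\frac{\eta_k}{\eta_t(t-k)}+\Big(\sum_{k=1}^{t-1}\frac{\eta_k^2}{\eta_t(t-k)}+\eta_t\Big)+\frac{\big(\sum_{k=1}^t\eta_k\big)^{1-\beta}}{\eta_t\,t}\right),$$ where empty sums are zero and $\mathbb E$ is over $S$ and $j_1,j_2,\dots$. -/

import Mathlib

open MeasureTheory
open scoped InnerProductSpace

universe u v w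

noncomputable section

namespace SGM

/-- The left-hand derivative `g'₋(a)` of a function on the real line. -/
def leftDeriv (g : ℝ → ℝ) (a : ℝ) : ℝ := derivWithin g (Set.Iio a) a

section Risk

variable {X : Type u} {Y : Type v} {F : Type w}
  [NormedAddCommGroup F] [InnerProductSpace ℝ F]

/-- The expected risk `𝓔(w) = ∫ ℓ(y, ⟨w, Φ(x)⟩) dρ(x, y)` of the linear predictor with
parameter `w`. -/
def risk [MeasurableSpace X] [MeasurableSpace Y] (ρ : Measure (X × Y)) (ℓ : Y → ℝ → ℝ)
    (Φ : X → F) (w : F) : ℝ :=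
  ∫ z, ℓ z.2 ⟪w, Φ z.1⟫_ℝ ∂ρ

/-- The approximation error `𝓓(lam) = inf_w {𝓔(w) + (lam / 2) ‖w‖²} - inf_w 𝓔(w)`. -/
def approxError [MeasurableSpace X] [MeasurableSpace Y] (ρ : Measure (X × Y)) (ℓ : Y → ℝ → ℝ)
    (Φ : X → F) (lam : ℝ) : ℝ :=
  (⨅ w : F, (risk ρ ℓ Φ w + lam / 2 * ‖w‖ ^ 2)) - ⨅ w : F, risk ρ ℓ Φ w

/-- The iterates of the stochastic gradient method on the sample `S`, with step-sizes
`η 1, η 2, …` and drawn indices `j 1, j 2, …`: `w₁ = 0` and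
`w_{t+1} = w_t - η_t ℓ'₋(y_{j_t}, ⟨w_t, Φ(x_{j_t})⟩) Φ(x_{j_t})` for `t ≥ 1`.
Time starts at `1`; the value at `0` is a placeholder that is never used. -/
def iterate (ℓ : Y → ℝ → ℝ) (Φ : X → F) (η : ℕ → ℝ) {n : ℕ} (S : Fin n → X × Y)
    (j : ℕ → Fin n) : ℕ → F
  | 0 => 0
  | 1 => 0
  | t + 2 =>
      iterate ℓ Φ η S j (t + 1) -
        (η (t + 1) *
          leftDeriv (ℓ (S (j (t + 1))).2)
            ⟪iterate ℓ Φ η S j (t + 1), Φ (S (j (t + 1))).1⟫_ℝ) • Φ (S (j (t + 1))).1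

/-- The weighted average `(∑_{k=1}^t η_k w_k) / (∑_{k=1}^t η_k)` of the iterates. -/
def average (ℓ : Y → ℝ → ℝ) (Φ : X → F) (η : ℕ → ℝ) {n : ℕ} (S : Fin n → X × Y)
    (j : ℕ → Fin n) (t : ℕ) : F :=
  (∑ k ∈ Finset.Icc 1 t, η k)⁻¹ • ∑ k ∈ Finset.Icc 1 t, η k • iterate ℓ Φ η S j k

end Risk

/-- The joint law of the sample and of the drawn indices: `S` consists of `n` independent draws
from `ρ`, the indices `j t` are i.i.d. uniform on the `n` sample points, and `S` and `j` are
independent of each other. -/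
def law {X : Type u} {Y : Type v} [MeasurableSpace X] [MeasurableSpace Y]
    (ρ : Measure (X × Y)) (n : ℕ) [NeZero n] :
    Measure ((Fin n → X × Y) × (ℕ → Fin n)) :=
  (Measure.pi fun _ : Fin n => ρ).prod
    (Measure.infinitePi fun _ : ℕ => (PMF.uniformOfFintype (Fin n)).toMeasure)

end SGM

end

/-! Put G = a₀κ and Λ = ∑_{k ≤ t} η_k. The excess risk splits into a generalization gap (risk minus
empirical risk), an optimization error and the approximation error.

Generalization is stability. The derivative of a smooth convex function of one variable is
cocoercive, so a gradient step with η_k ≤ 2/(κ²L) is nonexpansive (`norm_gradient_step_sub_le`). Two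
runs whose samples differ only at point i therefore separate only when i is drawn, by at most 2Gη_k.
Each time draws one index, so these displacements, summed over i, are at most 2GΛ. Exchanging a
sample point with a fresh one turns this into a gap of at most 2G²Λ/n
(`integral_popRisk_sub_empRisk_le_of_stable`).

Optimization is the expansion of ‖w_{k+1} - v‖², averaged over the draw j_k, of which w_k and v are
independent, and then telescoped (`sum_meanEmpRisk_sub_le`). Against a fixed w the regret is at most
‖w‖²/2 + (G²/2)∑η_k². Divided by Λ, the first term is the penalty with λ = 1/Λ, so the infimum over
w produces 𝓓(1/Λ) ≤ c Λ^{-β}. Jensen's inequality finishes the averaged iterate.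

For the last iterate the competitor is an earlier iterate w_s, which compares w_s with the average
over the suffix [s, t]. Lengthening the suffix one step at a time links the last value to the full
average (`mul_zero_le_of_suffix_sums`). Since the weights are not constant, this needs a lower bound
on the mean empirical risk minus inf 𝓔. The generalization bound supplies it, and so Λ/n gets
multiplied by ∑ η_k/(η_t(t-k)).

Smoothness enters the estimates only through nonexpansiveness, and the bound on ℓ(y, 0) only through
integrability; hence C depends on neither. -/

namespace SGM

/-! ### Resampling and exchanging coordinates of product measures -/

section Resampling

/-- Replacing one coordinate by an independent copy preserves an infinite product measure. -/
theorem measurePreserving_update_infinitePi {ι Ω : Type*} [MeasurableSpace Ω] [DecidableEq ι]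
    (ν : Measure Ω) [IsProbabilityMeasure ν] (k : ι) :
    MeasurePreserving (fun p : (ι → Ω) × Ω => Function.update p.1 k p.2)
      ((Measure.infinitePi fun _ : ι => ν).prod ν) (Measure.infinitePi fun _ : ι => ν) := by
  have hm : Measurable (fun p : (ι → Ω) × Ω => Function.update p.1 k p.2) := by
    refine measurable_pi_iff.2 fun l => ?_
    by_cases h : l = k
    · subst h; simpa using measurable_snd
    · simp only [Function.update_of_ne h]; fun_prop
  refine ⟨hm, Measure.eq_infinitePi _ fun s t ht => ?_⟩
  rw [Measure.map_apply hm (MeasurableSet.pi s.countable_toSet fun i _ => ht i)]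
  by_cases hk : k ∈ s
  · have : (fun p : (ι → Ω) × Ω => Function.update p.1 k p.2) ⁻¹' Set.pi s t
        = (Set.pi (s.erase k : Finset ι) t) ×ˢ t k := by
      ext ⟨a, b⟩
      simp only [Set.mem_preimage, Set.mem_pi, Finset.mem_coe, Set.mem_prod, Finset.mem_erase]
      constructor
      · intro h
        refine ⟨fun i hi => ?_, by simpa using h k hk⟩
        simpa [Function.update_of_ne hi.1] using h i hi.2
      · rintro ⟨h1, h2⟩ i hi
        by_cases h : i = k
        · subst h; simpa using h2
        · simpa [Function.update_of_ne h] using h1 i ⟨h, hi⟩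
    rw [this, Measure.prod_prod, Measure.infinitePi_pi _ fun i _ => ht i,
      Finset.prod_erase_mul _ _ hk]
  · have : (fun p : (ι → Ω) × Ω => Function.update p.1 k p.2) ⁻¹' Set.pi s t
        = (Set.pi s t) ×ˢ Set.univ := by
      ext ⟨a, b⟩
      simp only [Set.mem_preimage, Set.mem_pi, Finset.mem_coe, Set.mem_prod, Set.mem_univ, and_true]
      refine forall₂_congr fun i hi => ?_
      rw [Function.update_of_ne (ne_of_mem_of_not_mem (Finset.mem_coe.1 hi) hk)]
    rw [this, Measure.prod_prod, Measure.infinitePi_pi _ fun i _ => ht i, measure_univ, mul_one]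

/-- Exchanging one coordinate of an i.i.d. sample with a fresh copy preserves the joint law. -/
theorem measurePreserving_swap_coordinate {ι Ω : Type*} [MeasurableSpace Ω] [DecidableEq ι]
    [Fintype ι] (ν : Measure Ω) [IsProbabilityMeasure ν] (i : ι) :
    MeasurePreserving (fun p : (ι → Ω) × Ω => (Function.update p.1 i p.2, p.1 i))
      ((Measure.pi fun _ : ι => ν).prod ν) ((Measure.pi fun _ : ι => ν).prod ν) := by
  have hm : Measurable (fun p : (ι → Ω) × Ω => (Function.update p.1 i p.2, p.1 i)) := by
    refine Measurable.prodMk (measurable_pi_iff.2 fun l => ?_)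
      ((measurable_pi_apply i).comp measurable_fst)
    by_cases h : l = i
    · subst h; simpa using measurable_snd
    · simp only [Function.update_of_ne h]; fun_prop
  refine ⟨hm, (Measure.prod_eq_generateFrom generateFrom_pi MeasurableSpace.generateFrom_measurableSet
    isPiSystem_pi MeasurableSpace.isPiSystem_measurableSet
    (Measure.FiniteSpanningSetsIn.pi fun _ => ν.toFiniteSpanningSetsIn)
    ν.toFiniteSpanningSetsIn ?_).symm⟩
  rintro _ ⟨s, hs, rfl⟩ t ht
  have hs' : ∀ l, MeasurableSet (s l) := fun l => hs l (Set.mem_univ l)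
  rw [Measure.map_apply hm ((MeasurableSet.univ_pi hs').prod ht)]
  -- The preimage of a box is again a box, with the sides `s i` and `t` interchanged.
  have : (fun p : (ι → Ω) × Ω => (Function.update p.1 i p.2, p.1 i)) ⁻¹' (Set.univ.pi s ×ˢ t)
      = (Set.univ.pi (Function.update s i t)) ×ˢ s i := by
    ext ⟨a, b⟩
    simp only [Set.mem_preimage, Set.mem_prod, Set.mem_pi, Set.mem_univ, true_imp_iff]
    constructor
    · rintro ⟨h1, h2⟩
      refine ⟨fun l => ?_, by simpa using h1 i⟩
      by_cases h : l = i
      · subst h; simpa using h2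
      · simpa [Function.update_of_ne h] using h1 l
    · rintro ⟨h1, h2⟩
      refine ⟨fun l => ?_, by simpa using h1 i⟩
      by_cases h : l = i
      · subst h; simpa using h2
      · simpa [Function.update_of_ne h] using h1 l
  rw [this, Measure.prod_prod, Measure.pi_pi, Measure.pi_pi,
    ← Finset.mul_prod_erase Finset.univ (fun l => ν (s l)) (Finset.mem_univ i),
    ← Finset.mul_prod_erase Finset.univ (fun l => ν (Function.update s i t l)) (Finset.mem_univ i),
    Finset.prod_congr rfl (g := fun l => ν (s l))
      (fun l hl => by rw [Function.update_of_ne (Finset.ne_of_mem_erase hl)]),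
    Function.update_self]
  ring

/-- Averaging over a uniformly drawn coordinate on which the rest of the integrand does not
depend. -/
theorem integral_infinitePi_uniform_eval {n : ℕ} [NeZero n] (k : ℕ)
    (φ : (ℕ → Fin n) → Fin n → ℝ) (hφ : ∀ i, Measurable fun j => φ j i)
    (hdep : ∀ j i i', φ (Function.update j k i) i' = φ j i') {B : ℝ} (hB : ∀ j i, |φ j i| ≤ B) :
    ∫ j, φ j (j k) ∂(Measure.infinitePi fun _ : ℕ => (PMF.uniformOfFintype (Fin n)).toMeasure)
      = ∫ j, (n : ℝ)⁻¹ * ∑ i, φ j i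
          ∂(Measure.infinitePi fun _ : ℕ => (PMF.uniformOfFintype (Fin n)).toMeasure) := by
  set ν := (PMF.uniformOfFintype (Fin n)).toMeasure
  have hmφ : Measurable (Function.uncurry φ) := measurable_from_prod_countable_left hφ
  have hm : Measurable fun j : ℕ → Fin n => φ j (j k) :=
    hmφ.comp (measurable_id.prodMk (measurable_pi_apply k))
  rw [← (measurePreserving_update_infinitePi ν k).map_eq,
    integral_map (measurePreserving_update_infinitePi ν k).aemeasurable
      hm.aestronglyMeasurable, (measurePreserving_update_infinitePi ν k).map_eq]
  simp only [Function.update_self, hdep]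
  rw [integral_prod (fun p : (ℕ → Fin n) × Fin n => φ p.1 p.2) (Integrable.of_bound hmφ.aestronglyMeasurable B
    (Filter.Eventually.of_forall fun p => hB p.1 p.2))]
  refine integral_congr_ae (Filter.Eventually.of_forall fun j => ?_)
  simp only [ν]
  rw [PMF.integral_eq_sum]
  simp [Finset.mul_sum]

end Resampling

/-! ### Pathwise bounds for nonexpansive gradient steps -/

section Abstract

variable {Z F : Type*} [NormedAddCommGroup F] [InnerProductSpace ℝ F]

/-- A convex `G`-Lipschitz loss `f` with subgradient `g`, whose gradient steps of size `η k` are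
nonexpansive. -/
structure NonexpansiveModel [MeasurableSpace Z] [MeasurableSpace F] (f : F → Z → ℝ) (g : F → Z → F) (G M : ℝ)
    (η : ℕ → ℝ) : Prop where
  measurable_loss : Measurable (Function.uncurry f)
  measurable_grad : Measurable (Function.uncurry g)
  lip_nonneg : 0 ≤ G
  lipschitz : ∀ w v z, |f w z - f v z| ≤ G * ‖w - v‖
  subgradient : ∀ w v z, f w z - f v z ≤ ⟪g w z, w - v⟫_ℝ
  norm_grad_le : ∀ w z, ‖g w z‖ ≤ G
  nonexpansive : ∀ k, 1 ≤ k → ∀ w v z, ‖(w - η k • g w z) - (v - η k • g v z)‖ ≤ ‖w - v‖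
  nonneg : ∀ w z, 0 ≤ f w z
  zero_le : ∀ z, f 0 z ≤ M
  step_pos : ∀ k, 1 ≤ k → 0 < η k

/-- The stochastic (sub)gradient iterates, started at time `1` from `0`. -/
noncomputable def sgd (g : F → Z → F) (η : ℕ → ℝ) {n : ℕ} (S : Fin n → Z) (j : ℕ → Fin n) : ℕ → F
  | 0 => 0
  | 1 => 0
  | t + 2 => sgd g η S j (t + 1) - η (t + 1) • g (sgd g η S j (t + 1)) (S (j (t + 1)))

/-- The weighted average of the iterates. -/
noncomputable def sgdAverage (g : F → Z → F) (η : ℕ → ℝ) {n : ℕ} (S : Fin n → Z) (j : ℕ → Fin n) (t : ℕ) : F :=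
  (∑ k ∈ Finset.Icc 1 t, η k)⁻¹ • ∑ k ∈ Finset.Icc 1 t, η k • sgd g η S j k

/-- The expected loss. -/
noncomputable def popRisk [MeasurableSpace Z] (f : F → Z → ℝ) (ρ : Measure Z) (w : F) : ℝ := ∫ z, f w z ∂ρ

/-- The mean loss on the sample. -/
noncomputable def empRisk (f : F → Z → ℝ) {n : ℕ} (S : Fin n → Z) (w : F) : ℝ := (n : ℝ)⁻¹ * ∑ i, f w (S i)

theorem sgd_succ (g : F → Z → F) (η : ℕ → ℝ) {n : ℕ} (S : Fin n → Z) (j : ℕ → Fin n) {t : ℕ}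
    (ht : 1 ≤ t) :
    sgd g η S j (t + 1) = sgd g η S j t - η t • g (sgd g η S j t) (S (j t)) := by
  obtain ⟨s, rfl⟩ := Nat.exists_eq_add_of_le' ht
  rfl

@[simp] theorem sgd_one (g : F → Z → F) (η : ℕ → ℝ) {n : ℕ} (S : Fin n → Z) (j : ℕ → Fin n) :
    sgd g η S j 1 = 0 := rfl

/-- The iterate at time `t` uses only the draws before `t`. This is the independence that allows
averaging over `j k` while the iterate at time `k` and any earlier competitor stay fixed. -/
theorem sgd_update_index (g : F → Z → F) (η : ℕ → ℝ) {n : ℕ} (S : Fin n → Z) (j : ℕ → Fin n)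
    (i : Fin n) {t k : ℕ} (ht : 1 ≤ t) (htk : t ≤ k) :
    sgd g η S (Function.update j k i) t = sgd g η S j t := by
  induction t, ht using Nat.le_induction with
  | base => simp
  | succ t ht ih =>
    rw [sgd_succ _ _ _ _ ht, sgd_succ _ _ _ _ ht, ih (by omega),
      Function.update_of_ne (by omega)]

theorem norm_weighted_average_le {ι : Type*} (s : Finset ι) (η : ι → ℝ) (hη : ∀ k ∈ s, 0 ≤ η k)
    (v : ι → F) {R : ℝ} (hR : 0 ≤ R) (hv : ∀ k ∈ s, ‖v k‖ ≤ R) :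
    ‖(∑ k ∈ s, η k)⁻¹ • ∑ k ∈ s, η k • v k‖ ≤ R := by
  have h0 : 0 ≤ ∑ k ∈ s, η k := Finset.sum_nonneg hη
  rw [norm_smul, Real.norm_of_nonneg (inv_nonneg.2 h0)]
  have h1 : ‖∑ k ∈ s, η k • v k‖ ≤ (∑ k ∈ s, η k) * R := by
    rw [Finset.sum_mul]
    refine norm_sum_le_of_le _ fun k hk => ?_
    rw [norm_smul, Real.norm_of_nonneg (hη k hk)]
    exact mul_le_mul_of_nonneg_left (hv k hk) (hη k hk)
  -- With total weight zero the inverse is `0` and so is the average; this covers the empty average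
  -- at time `0`.
  rcases h0.eq_or_lt with h | h
  · rw [← h]; simpa using hR
  · calc _ ≤ (∑ k ∈ s, η k)⁻¹ * ((∑ k ∈ s, η k) * R) := by gcongr
      _ = R := by field_simp

namespace NonexpansiveModel

variable [MeasurableSpace Z] [MeasurableSpace F] {f : F → Z → ℝ} {g : F → Z → F} {G M : ℝ} {η : ℕ → ℝ}

theorem loss_le (h : NonexpansiveModel f g G M η) (w : F) (z : Z) : f w z ≤ M + G * ‖w‖ := by
  have h1 := (abs_le.1 (h.lipschitz w 0 z)).2
  have h2 := h.zero_le z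
  rw [sub_zero] at h1
  linarith

theorem abs_loss_le (h : NonexpansiveModel f g G M η) {w : F} {R : ℝ} (hw : ‖w‖ ≤ R) (z : Z) :
    |f w z| ≤ M + G * R := by
  rw [abs_of_nonneg (h.nonneg w z)]
  have := mul_le_mul_of_nonneg_left hw h.lip_nonneg
  linarith [h.loss_le w z]

theorem measurable_loss_left (h : NonexpansiveModel f g G M η) (w : F) : Measurable (f w) :=
  h.measurable_loss.comp (measurable_const.prodMk measurable_id)

theorem integrable_loss (h : NonexpansiveModel f g G M η) (ρ : Measure Z) [IsFiniteMeasure ρ]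
    (w : F) : Integrable (f w) ρ :=
  Integrable.of_bound (h.measurable_loss_left w).aestronglyMeasurable (M + G * ‖w‖)
    (Filter.Eventually.of_forall fun z => h.abs_loss_le le_rfl z)

theorem popRisk_nonneg (h : NonexpansiveModel f g G M η) (ρ : Measure Z) (w : F) :
    0 ≤ popRisk f ρ w := integral_nonneg fun z => h.nonneg w z

theorem abs_popRisk_le (h : NonexpansiveModel f g G M η) (ρ : Measure Z) [IsProbabilityMeasure ρ]
    {w : F} {R : ℝ} (hw : ‖w‖ ≤ R) : |popRisk f ρ w| ≤ M + G * R := by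
  have hb : ∀ᵐ z ∂ρ, ‖f w z‖ ≤ M + G * R :=
    Filter.Eventually.of_forall fun z => h.abs_loss_le hw z
  simpa [popRisk] using norm_integral_le_of_norm_le_const hb

theorem abs_empRisk_le (h : NonexpansiveModel f g G M η) {n : ℕ} [NeZero n] (S : Fin n → Z)
    {w : F} {R : ℝ} (hw : ‖w‖ ≤ R) : |empRisk f S w| ≤ M + G * R := by
  have hn : (0 : ℝ) < n := Nat.cast_pos.2 (NeZero.pos n)
  rw [empRisk, abs_mul, abs_of_pos (inv_pos.2 hn), inv_mul_le_iff₀ hn]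
  refine (Finset.abs_sum_le_sum_abs _ _).trans ?_
  exact (Finset.sum_le_card_nsmul Finset.univ (fun i => |f w (S i)|) _
    fun i _ => h.abs_loss_le hw (S i)).trans_eq (by rw [nsmul_eq_mul]; simp)

/-- A crude growth bound, uniform over samples and draws. It serves integrability only and does not
enter the rates. -/
theorem norm_sgd_le (h : NonexpansiveModel f g G M η) {n : ℕ} (S : Fin n → Z) (j : ℕ → Fin n)
    {t : ℕ} (ht : 1 ≤ t) : ‖sgd g η S j t‖ ≤ G * ∑ k ∈ Finset.Ico 1 t, η k := by
  induction t, ht using Nat.le_induction with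
  | base => simp
  | succ t ht ih =>
    rw [sgd_succ _ _ _ _ ht, Finset.sum_Ico_succ_top ht, mul_add]
    refine (norm_sub_le _ _).trans (add_le_add ih ?_)
    rw [norm_smul, Real.norm_of_nonneg (h.step_pos t ht).le, mul_comm]
    exact mul_le_mul_of_nonneg_right (h.norm_grad_le _ _) (h.step_pos t ht).le

theorem norm_sgd_le_of_le (h : NonexpansiveModel f g G M η) {n : ℕ} (S : Fin n → Z)
    (j : ℕ → Fin n) {s t : ℕ} (hs : 1 ≤ s) (hst : s ≤ t) :
    ‖sgd g η S j s‖ ≤ G * ∑ k ∈ Finset.Ico 1 t, η k :=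
  (h.norm_sgd_le S j hs).trans <| mul_le_mul_of_nonneg_left
    (Finset.sum_le_sum_of_subset_of_nonneg (Finset.Ico_subset_Ico le_rfl hst)
      fun k hk _ => (h.step_pos k (Finset.mem_Ico.1 hk).1).le) h.lip_nonneg

theorem sum_step_nonneg (h : NonexpansiveModel f g G M η) (t : ℕ) :
    0 ≤ ∑ k ∈ Finset.Ico 1 t, η k :=
  Finset.sum_nonneg fun k hk => (h.step_pos k (Finset.mem_Ico.1 hk).1).le

/-- Changing one sample point moves the iterates only when that point is drawn. -/
theorem norm_sgd_update_sub_le (h : NonexpansiveModel f g G M η) {n : ℕ} (S : Fin n → Z)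
    (j : ℕ → Fin n) (i : Fin n) (z : Z) {t : ℕ} (ht : 1 ≤ t) :
    ‖sgd g η (Function.update S i z) j t - sgd g η S j t‖
      ≤ ∑ k ∈ Finset.Ico 1 t, if j k = i then 2 * G * η k else 0 := by
  induction t, ht using Nat.le_induction with
  | base => simp
  | succ t ht ih =>
    rw [sgd_succ _ _ _ _ ht, sgd_succ _ _ _ _ ht, Finset.sum_Ico_succ_top ht]
    set w := sgd g η (Function.update S i z) j t
    set v := sgd g η S j t
    have hη := (h.step_pos t ht).le
    split_ifs with hj
    · have e : w - η t • g w (Function.update S i z (j t)) - (v - η t • g v (S (j t)))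
          = (w - v) + (η t • g v (S (j t)) - η t • g w (Function.update S i z (j t))) := by abel
      rw [e]
      refine (norm_add_le _ _).trans (add_le_add ih ((norm_sub_le _ _).trans ?_))
      rw [norm_smul, norm_smul, Real.norm_of_nonneg hη]
      nlinarith [h.norm_grad_le v (S (j t)), h.norm_grad_le w (Function.update S i z (j t))]
    · rw [Function.update_of_ne hj, add_zero]
      exact (h.nonexpansive t ht w v _).trans ih

/-- Each time draws exactly one index, so after exchanging the sums every step is counted once. The
bound holds for every index sequence; the factor `1 / n` comes later, from the empirical mean. -/
theorem sum_norm_sgd_update_sub_le (h : NonexpansiveModel f g G M η) {n : ℕ} (S : Fin n → Z)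
    (j : ℕ → Fin n) (z : Z) {t : ℕ} (ht : 1 ≤ t) :
    ∑ i, ‖sgd g η (Function.update S i z) j t - sgd g η S j t‖
      ≤ 2 * G * ∑ k ∈ Finset.Ico 1 t, η k := by
  refine (Finset.sum_le_sum fun i _ => h.norm_sgd_update_sub_le S j i z ht).trans ?_
  rw [Finset.sum_comm, Finset.mul_sum]
  simp

theorem sum_norm_sgdAverage_update_sub_le (h : NonexpansiveModel f g G M η) {n : ℕ}
    (S : Fin n → Z) (j : ℕ → Fin n) (z : Z) (t : ℕ) :
    ∑ i, ‖sgdAverage g η (Function.update S i z) j t - sgdAverage g η S j t‖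
      ≤ 2 * G * ∑ k ∈ Finset.Ico 1 t, η k := by
  have hη : ∀ k ∈ Finset.Icc 1 t, 0 ≤ η k := fun k hk => (h.step_pos k (Finset.mem_Icc.1 hk).1).le
  have h0 : 0 ≤ ∑ k ∈ Finset.Icc 1 t, η k := Finset.sum_nonneg hη
  set D : ℕ → Fin n → ℝ := fun k i => ‖sgd g η (Function.update S i z) j k - sgd g η S j k‖
  have hD : ∀ k ∈ Finset.Icc 1 t, ∑ i, D k i ≤ 2 * G * ∑ k ∈ Finset.Ico 1 t, η k := by
    intro k hk
    rw [Finset.mem_Icc] at hk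
    refine (h.sum_norm_sgd_update_sub_le S j z hk.1).trans
      (mul_le_mul_of_nonneg_left ?_ (by linarith [h.lip_nonneg]))
    exact Finset.sum_le_sum_of_subset_of_nonneg (Finset.Ico_subset_Ico le_rfl hk.2)
      fun l hl _ => (h.step_pos l (Finset.mem_Ico.1 hl).1).le
  have key : ∀ i, ‖sgdAverage g η (Function.update S i z) j t - sgdAverage g η S j t‖
      ≤ (∑ k ∈ Finset.Icc 1 t, η k)⁻¹ * ∑ k ∈ Finset.Icc 1 t, η k * D k i := by
    intro i
    rw [sgdAverage, sgdAverage, ← smul_sub, ← Finset.sum_sub_distrib, norm_smul,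
      Real.norm_of_nonneg (inv_nonneg.2 h0)]
    refine mul_le_mul_of_nonneg_left (norm_sum_le_of_le _ fun k hk => ?_) (inv_nonneg.2 h0)
    rw [← smul_sub, norm_smul, Real.norm_of_nonneg (hη k hk)]
  refine (Finset.sum_le_sum fun i _ => key i).trans ?_
  rw [← Finset.mul_sum, Finset.sum_comm]
  simp_rw [← Finset.mul_sum]
  have h2 : (0 : ℝ) ≤ 2 * G * ∑ k ∈ Finset.Ico 1 t, η k :=
    mul_nonneg (by linarith [h.lip_nonneg]) (h.sum_step_nonneg t)
  have := norm_weighted_average_le (F := ℝ) (Finset.Icc 1 t) η hη (fun k => ∑ i, D k i) h2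
    (fun k hk => by
      rw [Real.norm_of_nonneg (Finset.sum_nonneg fun i _ => norm_nonneg _)]
      exact hD k hk)
  exact (le_abs_self _).trans this

end NonexpansiveModel

end Abstract

/-! ### Integrability and the generalization gap -/

section Abstract

variable {Z F : Type*} [MeasurableSpace Z] [NormedAddCommGroup F] [InnerProductSpace ℝ F]
  [MeasurableSpace F]

/-- The joint law of an i.i.d. sample and of independent uniform indices. -/
noncomputable def sampleLaw (ρ : Measure Z) (n : ℕ) [NeZero n] : Measure ((Fin n → Z) × (ℕ → Fin n)) :=
  (Measure.pi fun _ : Fin n => ρ).prod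
    (Measure.infinitePi fun _ : ℕ => (PMF.uniformOfFintype (Fin n)).toMeasure)

instance (ρ : Measure Z) [IsProbabilityMeasure ρ] (n : ℕ) [NeZero n] :
    IsProbabilityMeasure (sampleLaw ρ n) := by
  unfold sampleLaw; infer_instance

theorem measurable_drawn (n : ℕ) (k : ℕ) :
    Measurable fun ω : (Fin n → Z) × (ℕ → Fin n) => ω.1 (ω.2 k) := by
  have h : Measurable fun p : (Fin n → Z) × Fin n => p.1 p.2 :=
    measurable_from_prod_countable_left fun i => measurable_pi_apply i
  exact h.comp (measurable_fst.prodMk ((measurable_pi_apply k).comp measurable_snd))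

namespace NonexpansiveModel

variable {f : F → Z → ℝ} {g : F → Z → F} {G M : ℝ} {η : ℕ → ℝ}

section Measurability

variable [BorelSpace F] [SecondCountableTopology F]

theorem measurable_sgd (h : NonexpansiveModel f g G M η) (n t : ℕ) :
    Measurable fun ω : (Fin n → Z) × (ℕ → Fin n) => sgd g η ω.1 ω.2 t := by
  rcases Nat.eq_zero_or_pos t with rfl | ht
  · exact measurable_const
  induction t, ht using Nat.le_induction with
  | base => exact measurable_const
  | succ t ht ih =>
    simp only [sgd_succ _ _ _ _ ht]
    exact ih.sub ((h.measurable_grad.comp (ih.prodMk (measurable_drawn n t))).const_smul (η t))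

theorem measurable_sgdAverage (h : NonexpansiveModel f g G M η) (n t : ℕ) :
    Measurable fun ω : (Fin n → Z) × (ℕ → Fin n) => sgdAverage g η ω.1 ω.2 t :=
  (Finset.measurable_sum _ fun k _ => (h.measurable_sgd n k).const_smul (η k)).const_smul _

end Measurability

theorem measurable_popRisk (h : NonexpansiveModel f g G M η) (ρ : Measure Z) [SFinite ρ] :
    Measurable (popRisk f ρ) :=
  (h.measurable_loss.stronglyMeasurable.integral_prod_right (ν := ρ)).measurable

theorem measurable_empRisk {Ω : Type*} [MeasurableSpace Ω] (h : NonexpansiveModel f g G M η)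
    {n : ℕ} {S : Ω → Fin n → Z} {v : Ω → F} (hS : Measurable S) (hv : Measurable v) :
    Measurable fun ω => empRisk f (S ω) (v ω) :=
  (Finset.measurable_sum _ fun i _ =>
    h.measurable_loss.comp (hv.prodMk ((measurable_pi_apply i).comp hS))).const_mul _

theorem integrable_popRisk {Ω : Type*} [MeasurableSpace Ω] (h : NonexpansiveModel f g G M η)
    (ρ : Measure Z) [IsProbabilityMeasure ρ] (P : Measure Ω) [IsFiniteMeasure P] {v : Ω → F}
    (hv : Measurable v) {R : ℝ} (hR : ∀ ω, ‖v ω‖ ≤ R) :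
    Integrable (fun ω => popRisk f ρ (v ω)) P :=
  Integrable.of_bound ((h.measurable_popRisk ρ).comp hv).aestronglyMeasurable (M + G * R)
    (Filter.Eventually.of_forall fun ω => h.abs_popRisk_le ρ (hR ω))

theorem integrable_empRisk {Ω : Type*} [MeasurableSpace Ω] (h : NonexpansiveModel f g G M η)
    (P : Measure Ω) [IsFiniteMeasure P] {n : ℕ} [NeZero n] {S : Ω → Fin n → Z} {v : Ω → F}
    (hS : Measurable S) (hv : Measurable v) {R : ℝ} (hR : ∀ ω, ‖v ω‖ ≤ R) :
    Integrable (fun ω => empRisk f (S ω) (v ω)) P :=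
  Integrable.of_bound (h.measurable_empRisk hS hv).aestronglyMeasurable (M + G * R)
    (Filter.Eventually.of_forall fun ω => h.abs_empRisk_le (S ω) (hR ω))

theorem integrable_loss_comp {Ω : Type*} [MeasurableSpace Ω] (h : NonexpansiveModel f g G M η)
    (P : Measure Ω) [IsFiniteMeasure P] {s : Ω → Z} {v : Ω → F}
    (hs : Measurable s) (hv : Measurable v) {R : ℝ} (hR : ∀ ω, ‖v ω‖ ≤ R) :
    Integrable (fun ω => f (v ω) (s ω)) P :=
  Integrable.of_bound (h.measurable_loss.comp (hv.prodMk hs)).aestronglyMeasurable (M + G * R)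
    (Filter.Eventually.of_forall fun ω => h.abs_loss_le (hR ω) (s ω))

/-- Uniform stability on average bounds the generalization gap. -/
theorem integral_popRisk_sub_empRisk_le_of_stable (h : NonexpansiveModel f g G M η)
    (ρ : Measure Z) [IsProbabilityMeasure ρ] {n : ℕ} [NeZero n] {v : (Fin n → Z) → F}
    (hv : Measurable v) {R δ : ℝ} (hR : ∀ S, ‖v S‖ ≤ R)
    (hδ : ∀ S z, ∑ i, ‖v (Function.update S i z) - v S‖ ≤ δ) :
    ∫ S, (popRisk f ρ (v S) - empRisk f S (v S)) ∂(Measure.pi fun _ : Fin n => ρ)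
      ≤ G * δ / n := by
  set μ := Measure.pi fun _ : Fin n => ρ with hμ
  have hn : (0 : ℝ) < n := Nat.cast_pos.2 (NeZero.pos n)
  have hupd : ∀ i, Measurable fun p : (Fin n → Z) × Z => Function.update p.1 i p.2 := fun i =>
    (measurePreserving_swap_coordinate ρ i).measurable.fst
  have hc : ∀ i, Measurable fun p : (Fin n → Z) × Z => p.1 i := fun i =>
    (measurePreserving_swap_coordinate ρ i).measurable.snd
  have hψ : ∀ i, Integrable (fun p : (Fin n → Z) × Z => f (v (Function.update p.1 i p.2)) (p.1 i))
      (μ.prod ρ) := fun i =>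
    h.integrable_loss_comp _ (hc i) (hv.comp (hupd i)) fun ω => hR _
  -- The fresh point and the `i`-th sample point trade places, so the risk becomes a loss at a
  -- sample point of a predictor trained without it. Averaging over `i` makes it comparable with the
  -- empirical risk term by term.
  have hpop : ∀ i, ∫ S, popRisk f ρ (v S) ∂μ
      = ∫ p : (Fin n → Z) × Z, f (v (Function.update p.1 i p.2)) (p.1 i) ∂(μ.prod ρ) := by
    intro i
    have hI : Integrable (fun p : (Fin n → Z) × Z => f (v p.1) p.2) (μ.prod ρ) :=
      h.integrable_loss_comp _ measurable_snd (hv.comp measurable_fst) fun ω => hR _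
    have h1 := integral_prod _ hI
    have h2 := (measurePreserving_swap_coordinate ρ i)
    rw [← hμ] at h2
    rw [show ∫ S, popRisk f ρ (v S) ∂μ = ∫ S, ∫ z, f (v S) z ∂ρ ∂μ from rfl, ← h1]
    conv_lhs => rw [← h2.map_eq]
    rw [integral_map h2.aemeasurable]
    rw [h2.map_eq]
    exact hI.aestronglyMeasurable
  have hpop' : ∫ S, popRisk f ρ (v S) ∂μ = ∫ p : (Fin n → Z) × Z,
      (n : ℝ)⁻¹ * ∑ i, f (v (Function.update p.1 i p.2)) (p.1 i) ∂(μ.prod ρ) := by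
    rw [integral_const_mul, integral_finsetSum _ fun i _ => hψ i,
      Finset.sum_congr rfl fun i _ => (hpop i).symm]
    simp [hn.ne']
  have hE : Integrable (fun p : (Fin n → Z) × Z => empRisk f p.1 (v p.1)) (μ.prod ρ) :=
    h.integrable_empRisk _ measurable_fst (hv.comp measurable_fst) fun ω => hR _
  have hemp : ∫ S, empRisk f S (v S) ∂μ
      = ∫ p : (Fin n → Z) × Z, empRisk f p.1 (v p.1) ∂(μ.prod ρ) := by
    rw [integral_prod _ hE]; simp
  rw [integral_sub (h.integrable_popRisk ρ μ hv hR) (h.integrable_empRisk μ (S := fun S => S) measurable_id hv hR),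
    hpop', hemp, ← integral_sub ((integrable_finsetSum _ fun i _ => hψ i).const_mul _) hE]
  have hle : ∀ p : (Fin n → Z) × Z,
      (n : ℝ)⁻¹ * ∑ i, f (v (Function.update p.1 i p.2)) (p.1 i) - empRisk f p.1 (v p.1)
        ≤ G * δ / n := by
    intro p
    rw [empRisk, ← mul_sub, ← Finset.sum_sub_distrib, inv_mul_eq_div]
    refine div_le_div_of_nonneg_right ?_ hn.le
    refine le_trans ?_ (mul_le_mul_of_nonneg_left (hδ p.1 p.2) h.lip_nonneg)
    rw [Finset.mul_sum]
    exact Finset.sum_le_sum fun i _ => (le_abs_self _).trans (h.lipschitz _ _ _)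
  refine (integral_mono (((integrable_finsetSum _ fun i _ => hψ i).const_mul _).sub hE)
    (integrable_const (G * δ / n)) hle).trans_eq ?_
  simp

/-- The loss at a freshly drawn sample point has the empirical risk as its mean. -/
theorem integral_loss_drawn (h : NonexpansiveModel f g G M η) (ρ : Measure Z)
    [IsProbabilityMeasure ρ] {n : ℕ} [NeZero n] (k : ℕ) {v : (Fin n → Z) × (ℕ → Fin n) → F}
    (hv : Measurable v) {R : ℝ} (hR : ∀ ω, ‖v ω‖ ≤ R)
    (hdep : ∀ S j i, v (S, Function.update j k i) = v (S, j)) :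
    ∫ ω, f (v ω) (ω.1 (ω.2 k)) ∂(sampleLaw ρ n) = ∫ ω, empRisk f ω.1 (v ω) ∂(sampleLaw ρ n) := by
  unfold sampleLaw
  rw [integral_prod _ (h.integrable_loss_comp _ (measurable_drawn n k) hv hR),
    integral_prod _ (h.integrable_empRisk _ measurable_fst hv hR)]
  refine integral_congr_ae (Filter.Eventually.of_forall fun S => ?_)
  exact integral_infinitePi_uniform_eval k (fun j i => f (v (S, j)) (S i))
    (fun i => h.measurable_loss.comp ((hv.comp measurable_prodMk_left).prodMk measurable_const))
    (fun j i i' => by simp only [hdep]) fun j i => h.abs_loss_le (hR _) (S i)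

/-- The expected empirical risk of the iterate at time `k`. -/
noncomputable def meanEmpRisk (f : F → Z → ℝ) (g : F → Z → F) (η : ℕ → ℝ) (ρ : Measure Z) (n : ℕ) [NeZero n]
    (k : ℕ) : ℝ := ∫ ω, empRisk f ω.1 (sgd g η ω.1 ω.2 k) ∂(sampleLaw ρ n)

theorem integral_empRisk_const (h : NonexpansiveModel f g G M η) (ρ : Measure Z)
    [IsProbabilityMeasure ρ] (n : ℕ) [NeZero n] (w : F) :
    ∫ ω, empRisk f ω.1 w ∂(sampleLaw ρ n) = popRisk f ρ w := by
  have hn : (n : ℝ) ≠ 0 := NeZero.ne _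
  have hi : ∀ i, Integrable (fun S : Fin n → Z => f w (S i)) (Measure.pi fun _ => ρ) := fun i =>
    h.integrable_loss_comp _ (measurable_pi_apply i) measurable_const fun _ => le_rfl
  unfold sampleLaw
  rw [integral_prod _ (h.integrable_empRisk _ measurable_fst measurable_const fun _ => le_rfl)]
  simp only [integral_const, probReal_univ, one_smul, empRisk]
  rw [integral_const_mul, integral_finsetSum _ fun i _ => hi i]
  have : ∀ i, ∫ S : Fin n → Z, f w (S i) ∂(Measure.pi fun _ => ρ) = popRisk f ρ w := fun i =>
    integral_comp_eval (μ := fun _ : Fin n => ρ)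
      (h.integrable_loss ρ w).aestronglyMeasurable
  simp [this, hn]

theorem norm_sgdAverage_le (h : NonexpansiveModel f g G M η) {n : ℕ} (S : Fin n → Z)
    (j : ℕ → Fin n) (t : ℕ) : ‖sgdAverage g η S j t‖ ≤ G * ∑ k ∈ Finset.Ico 1 t, η k :=
  norm_weighted_average_le _ _ (fun _ hk => (h.step_pos _ (Finset.mem_Icc.1 hk).1).le) _
    (mul_nonneg h.lip_nonneg (h.sum_step_nonneg t)) fun _ hk =>
      h.norm_sgd_le_of_le S j (Finset.mem_Icc.1 hk).1 (Finset.mem_Icc.1 hk).2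

/-- The generalization gap of a map of sample and indices that is stable in the sample. -/
theorem integral_sampleLaw_popRisk_sub_empRisk_le (h : NonexpansiveModel f g G M η)
    (ρ : Measure Z) [IsProbabilityMeasure ρ] {n : ℕ} [NeZero n]
    {v : (Fin n → Z) × (ℕ → Fin n) → F} (hv : Measurable v) {R δ : ℝ} (hR : ∀ ω, ‖v ω‖ ≤ R)
    (hδ : ∀ S j z, ∑ i, ‖v (Function.update S i z, j) - v (S, j)‖ ≤ δ) :
    ∫ ω, popRisk f ρ (v ω) ∂(sampleLaw ρ n) - ∫ ω, empRisk f ω.1 (v ω) ∂(sampleLaw ρ n)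
      ≤ G * δ / n := by
  have i1 := h.integrable_popRisk ρ (sampleLaw ρ n) hv hR
  have i2 := h.integrable_empRisk (sampleLaw ρ n) measurable_fst hv hR
  rw [← integral_sub i1 i2]
  have i3 : Integrable (fun ω => popRisk f ρ (v ω) - empRisk f ω.1 (v ω)) (sampleLaw ρ n) :=
    i1.sub i2
  unfold sampleLaw at i3 ⊢
  -- Stability holds for each fixed index sequence, so the sample is integrated first.
  rw [integral_prod_symm _ i3]
  refine (integral_mono i3.integral_prod_right (integrable_const (G * δ / n)) fun j => ?_).trans_eq
    (by simp)
  exact h.integral_popRisk_sub_empRisk_le_of_stable ρ (v := fun S => v (S, j))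
    (hv.comp measurable_prodMk_right) (fun S => hR _) (fun S z => hδ S j z)

/-! ### Regret in expectation -/

section Optimization

variable [BorelSpace F] [SecondCountableTopology F]

theorem integrable_dist_sq (h : NonexpansiveModel f g G M η) (ρ : Measure Z)
    [IsProbabilityMeasure ρ] {n : ℕ} [NeZero n] {k : ℕ} (hk : 1 ≤ k)
    {v : (Fin n → Z) × (ℕ → Fin n) → F} (hv : Measurable v) {R : ℝ} (hR : ∀ ω, ‖v ω‖ ≤ R) :
    Integrable (fun ω => ‖sgd g η ω.1 ω.2 k - v ω‖ ^ 2) (sampleLaw ρ n) := by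
  refine Integrable.of_bound
    (((h.measurable_sgd n k).sub hv).norm.pow_const 2).aestronglyMeasurable
    ((G * ∑ l ∈ Finset.Ico 1 k, η l + R) ^ 2) (Filter.Eventually.of_forall fun ω => ?_)
  rw [Real.norm_of_nonneg (by positivity)]
  gcongr
  exact (norm_sub_le _ _).trans (add_le_add (h.norm_sgd_le _ _ hk) (hR ω))

/-- Expand the square, apply the subgradient inequality at the drawn point, and replace the mean
loss there by the mean empirical risk. The competitor may be random provided that it ignores the
current draw. -/
theorem integral_step_le (h : NonexpansiveModel f g G M η) (ρ : Measure Z)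
    [IsProbabilityMeasure ρ] {n : ℕ} [NeZero n] {k : ℕ} (hk : 1 ≤ k)
    {v : (Fin n → Z) × (ℕ → Fin n) → F} (hv : Measurable v) {R : ℝ} (hR : ∀ ω, ‖v ω‖ ≤ R)
    (hdep : ∀ S j i, v (S, Function.update j k i) = v (S, j)) :
    2 * (η k * (meanEmpRisk f g η ρ n k - ∫ ω, empRisk f ω.1 (v ω) ∂(sampleLaw ρ n)))
        + ∫ ω, ‖sgd g η ω.1 ω.2 (k + 1) - v ω‖ ^ 2 ∂(sampleLaw ρ n)
      ≤ ∫ ω, ‖sgd g η ω.1 ω.2 k - v ω‖ ^ 2 ∂(sampleLaw ρ n) + G ^ 2 * η k ^ 2 := by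
  have hη := h.step_pos k hk
  have hw := h.measurable_sgd n k
  have hwR : ∀ ω : (Fin n → Z) × (ℕ → Fin n), ‖sgd g η ω.1 ω.2 k‖ ≤ _ :=
    fun ω => h.norm_sgd_le ω.1 ω.2 hk
  have hz := measurable_drawn (Z := Z) n k
  have pt : ∀ ω : (Fin n → Z) × (ℕ → Fin n),
      2 * η k * (f (sgd g η ω.1 ω.2 k) (ω.1 (ω.2 k)) - f (v ω) (ω.1 (ω.2 k)))
        + ‖sgd g η ω.1 ω.2 (k + 1) - v ω‖ ^ 2
      ≤ ‖sgd g η ω.1 ω.2 k - v ω‖ ^ 2 + G ^ 2 * η k ^ 2 := by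
    intro ω
    rw [sgd_succ _ _ _ _ hk]
    set w := sgd g η ω.1 ω.2 k
    set z := ω.1 (ω.2 k)
    have e : w - η k • g w z - v ω = (w - v ω) - η k • g w z := by abel
    rw [e, norm_sub_sq_real (w - v ω), norm_smul, Real.norm_of_nonneg hη.le, inner_smul_right,
      real_inner_comm, mul_pow]
    have h1 := mul_le_mul_of_nonneg_left (h.subgradient w (v ω) z) hη.le
    have h2 : ‖g w z‖ ^ 2 ≤ G ^ 2 := pow_le_pow_left₀ (norm_nonneg _) (h.norm_grad_le w z) 2
    have h3 := mul_le_mul_of_nonneg_left h2 (sq_nonneg (η k))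
    linarith
  have i1 := h.integrable_loss_comp (sampleLaw ρ n) hz hw hwR
  have i2 := h.integrable_loss_comp (sampleLaw ρ n) hz hv hR
  have i3 := h.integrable_dist_sq ρ (n := n) (k := k + 1) (by omega) hv hR
  have i4 := h.integrable_dist_sq ρ (n := n) hk hv hR
  have key := integral_mono (((i1.sub i2).const_mul (2 * η k)).add i3)
    (i4.add (integrable_const (G ^ 2 * η k ^ 2))) pt
  rw [integral_add' ((i1.sub i2).const_mul (2 * η k)) i3, integral_const_mul,
    integral_add' i4 (integrable_const _), integral_sub' i1 i2,
    h.integral_loss_drawn ρ k hw hwR (fun S j i => sgd_update_index g η S j i hk le_rfl),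
    h.integral_loss_drawn ρ k hv hR hdep] at key
  simp only [integral_const, probReal_univ, one_smul] at key
  rw [meanEmpRisk]
  linarith

/-- The one-step inequalities telescope. The competitor need only ignore the draws from time `s` on,
so the iterate at time `s` itself is admissible. -/
theorem sum_meanEmpRisk_sub_le (h : NonexpansiveModel f g G M η) (ρ : Measure Z)
    [IsProbabilityMeasure ρ] {n : ℕ} [NeZero n] {s t : ℕ} (hs : 1 ≤ s) (hst : s ≤ t)
    {v : (Fin n → Z) × (ℕ → Fin n) → F} (hv : Measurable v) {R : ℝ} (hR : ∀ ω, ‖v ω‖ ≤ R)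
    (hdep : ∀ k, s ≤ k → ∀ S j i, v (S, Function.update j k i) = v (S, j)) :
    2 * ∑ k ∈ Finset.Ico s t,
          η k * (meanEmpRisk f g η ρ n k - ∫ ω, empRisk f ω.1 (v ω) ∂(sampleLaw ρ n))
        + ∫ ω, ‖sgd g η ω.1 ω.2 t - v ω‖ ^ 2 ∂(sampleLaw ρ n)
      ≤ ∫ ω, ‖sgd g η ω.1 ω.2 s - v ω‖ ^ 2 ∂(sampleLaw ρ n)
        + G ^ 2 * ∑ k ∈ Finset.Ico s t, η k ^ 2 := by
  induction t, hst using Nat.le_induction with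
  | base => simp
  | succ t ht ih =>
    rw [Finset.sum_Ico_succ_top ht, Finset.sum_Ico_succ_top ht]
    have := h.integral_step_le ρ (n := n) (hs.trans ht) hv hR (hdep t ht)
    linarith

/-- Regret against a fixed competitor. -/
theorem sum_meanEmpRisk_sub_popRisk_le (h : NonexpansiveModel f g G M η) (ρ : Measure Z)
    [IsProbabilityMeasure ρ] (n : ℕ) [NeZero n] (t : ℕ) (w : F) :
    ∑ k ∈ Finset.Icc 1 t, η k * (meanEmpRisk f g η ρ n k - popRisk f ρ w)
      ≤ ‖w‖ ^ 2 / 2 + G ^ 2 / 2 * ∑ k ∈ Finset.Icc 1 t, η k ^ 2 := by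
  have := h.sum_meanEmpRisk_sub_le ρ (n := n) le_rfl (t := t + 1) (by omega)
    (v := fun _ => w) measurable_const (fun _ => le_rfl) (fun _ _ _ _ _ => rfl)
  rw [h.integral_empRisk_const] at this
  simp only [sgd_one, zero_sub, norm_neg, integral_const, probReal_univ, one_smul] at this
  have hp : 0 ≤ ∫ ω, ‖sgd g η ω.1 ω.2 (t + 1) - w‖ ^ 2 ∂(sampleLaw ρ n) :=
    integral_nonneg fun _ => by positivity
  rw [← Finset.Ico_succ_right_eq_Icc]
  simp only [Order.succ_eq_add_one]
  linarith

/-- Regret against an earlier iterate. -/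
theorem sum_meanEmpRisk_sub_meanEmpRisk_le (h : NonexpansiveModel f g G M η) (ρ : Measure Z)
    [IsProbabilityMeasure ρ] (n : ℕ) [NeZero n] {s t : ℕ} (hs : 1 ≤ s) (hst : s ≤ t) :
    ∑ k ∈ Finset.Icc s t, η k * (meanEmpRisk f g η ρ n k - meanEmpRisk f g η ρ n s)
      ≤ G ^ 2 / 2 * ∑ k ∈ Finset.Icc s t, η k ^ 2 := by
  have := h.sum_meanEmpRisk_sub_le ρ (n := n) hs (t := t + 1) (by omega)
    (v := fun ω => sgd g η ω.1 ω.2 s) (h.measurable_sgd n s) (fun ω => h.norm_sgd_le _ _ hs)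
    (fun k hk S j i => sgd_update_index g η S j i hs hk)
  simp only [sub_self, norm_zero] at this
  have hp : 0 ≤ ∫ ω, ‖sgd g η ω.1 ω.2 (t + 1) - sgd g η ω.1 ω.2 s‖ ^ 2 ∂(sampleLaw ρ n) :=
    integral_nonneg fun _ => by positivity
  rw [← Finset.Ico_succ_right_eq_Icc]
  simp only [Order.succ_eq_add_one]
  simp only [← meanEmpRisk.eq_1] at this
  norm_num at this
  linarith

theorem integral_popRisk_sgd_le (h : NonexpansiveModel f g G M η) (ρ : Measure Z)
    [IsProbabilityMeasure ρ] (n : ℕ) [NeZero n] {t : ℕ} (ht : 1 ≤ t) :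
    ∫ ω, popRisk f ρ (sgd g η ω.1 ω.2 t) ∂(sampleLaw ρ n)
      ≤ meanEmpRisk f g η ρ n t + 2 * G ^ 2 * (∑ k ∈ Finset.Ico 1 t, η k) / n := by
  have := h.integral_sampleLaw_popRisk_sub_empRisk_le ρ (h.measurable_sgd n t)
    (fun ω => h.norm_sgd_le _ _ ht) fun S j z => h.sum_norm_sgd_update_sub_le S j z ht
  rw [meanEmpRisk]
  have e : G * (2 * G * ∑ k ∈ Finset.Ico 1 t, η k) / n
      = 2 * G ^ 2 * (∑ k ∈ Finset.Ico 1 t, η k) / n := by ring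
  linarith

theorem integral_popRisk_sgdAverage_le (h : NonexpansiveModel f g G M η) (ρ : Measure Z)
    [IsProbabilityMeasure ρ] (n : ℕ) [NeZero n] (t : ℕ) :
    ∫ ω, popRisk f ρ (sgdAverage g η ω.1 ω.2 t) ∂(sampleLaw ρ n)
      ≤ ∫ ω, empRisk f ω.1 (sgdAverage g η ω.1 ω.2 t) ∂(sampleLaw ρ n)
        + 2 * G ^ 2 * (∑ k ∈ Finset.Ico 1 t, η k) / n := by
  have := h.integral_sampleLaw_popRisk_sub_empRisk_le ρ (h.measurable_sgdAverage n t)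
    (fun ω => h.norm_sgdAverage_le _ _ t) fun S j z =>
      h.sum_norm_sgdAverage_update_sub_le S j z t
  have e : G * (2 * G * ∑ k ∈ Finset.Ico 1 t, η k) / n
      = 2 * G ^ 2 * (∑ k ∈ Finset.Ico 1 t, η k) / n := by ring
  linarith

end Optimization

end NonexpansiveModel

end Abstract

/-! ### From suffix averages to the last iterate -/

section LastIterate

/-- From weighted suffix averages to the last value, with time running backwards: `u 0` is the
last value. -/
theorem mul_zero_le_of_suffix_sums {a u : ℕ → ℝ} {K B : ℝ} {N : ℕ}
    (ha : ∀ r < N, 0 ≤ a r) (hmono : ∀ r m, r ≤ m → m < N → a r ≤ a m)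
    (hu : ∀ r < N, -B ≤ u r)
    (hsum : ∀ m < N, ∑ r ∈ Finset.range (m + 1), a r * (u r - u m)
      ≤ K * ∑ r ∈ Finset.range (m + 1), a r ^ 2) (hB : 0 ≤ B) {m : ℕ} (hm : 1 ≤ m) (hmN : m ≤ N) :
    a 0 * u 0 ≤ (∑ r ∈ Finset.range m, a r * u r) / m
      + K * (∑ r ∈ Finset.Ico 1 m, a r ^ 2 / r + a 0 ^ 2 - (∑ r ∈ Finset.range m, a r ^ 2) / m)
      + B * ∑ r ∈ Finset.Ico 1 m, a r / r := by
  induction m, hm using Nat.le_induction with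
  | base => simp
  | succ m hm ih =>
    refine (ih (by omega)).trans ?_
    have hmN' : m < N := by omega
    have hm0 : (0 : ℝ) < m := by exact_mod_cast hm
    rw [Finset.sum_range_succ, Finset.sum_range_succ, Finset.sum_Ico_succ_top hm,
      Finset.sum_Ico_succ_top hm]
    set X := ∑ r ∈ Finset.range m, a r * u r
    set Q := ∑ r ∈ Finset.range m, a r ^ 2
    have h1 : X - (∑ r ∈ Finset.range m, a r) * u m ≤ K * (Q + a m ^ 2) := by
      have := hsum m hmN'
      rw [Finset.sum_range_succ, Finset.sum_range_succ, sub_self, mul_zero, add_zero] at this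
      simpa only [mul_sub, Finset.sum_sub_distrib, ← Finset.sum_mul] using this
    have h2 : ∑ r ∈ Finset.range m, a r ≤ m * a m := by
      have := Finset.sum_le_card_nsmul (Finset.range m) a (a m)
        fun r hr => hmono r m (Finset.mem_range.1 hr).le hmN'
      simpa using this
    have h3 : 0 ≤ ∑ r ∈ Finset.range m, a r :=
      Finset.sum_nonneg fun r hr => ha r ((Finset.mem_range.1 hr).trans hmN')
    set A := ∑ r ∈ Finset.range m, a r
    -- `A` is to be replaced by `m * a m`, which monotonicity makes at least as large. As `u m` may
    -- be negative, the exchange costs up to `m * a m * B`; this is the source of the `B` term.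
    have h4 : -(m * a m * B) ≤ (m * a m - A) * u m := by
      have e1 := mul_le_mul_of_nonneg_left (hu m hmN') (sub_nonneg.2 h2)
      have e2 := mul_nonneg h3 hB
      linarith
    have h5 : 0 ≤ B * a m := mul_nonneg hB (ha m hmN')
    -- Divided by `m * (m + 1)`, this says exactly that the claimed bound does not decrease from `m`
    -- to `m + 1`. The factor `m + 1`, rather than `m`, makes the increment `B * a m / m`.
    have h6 : X ≤ m * (a m * u m) + K * (Q + a m ^ 2) + B * a m * (m + 1) := by linarith
    have h7 := div_le_div_of_nonneg_right h6 (by positivity : (0 : ℝ) ≤ m * (m + 1))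
    have e : (X + a m * u m) / ((m + 1 : ℕ) : ℝ)
        + K * (∑ r ∈ Finset.Ico 1 m, a r ^ 2 / r + a m ^ 2 / m + a 0 ^ 2
          - (Q + a m ^ 2) / ((m + 1 : ℕ) : ℝ))
        + B * (∑ r ∈ Finset.Ico 1 m, a r / r + a m / m)
        - (X / m + K * (∑ r ∈ Finset.Ico 1 m, a r ^ 2 / r + a 0 ^ 2 - Q / m)
          + B * ∑ r ∈ Finset.Ico 1 m, a r / r)
        = (m * (a m * u m) + K * (Q + a m ^ 2) + B * a m * (m + 1)) / (m * (m + 1))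
          - X / (m * (m + 1)) := by
      push_cast
      field_simp
      ring
    linarith

/-- From weighted suffix averages to the last iterate, for non-increasing step-sizes. -/
theorem last_le_of_suffix_sums {η e : ℕ → ℝ} {K B c : ℝ} {t : ℕ} (ht : 1 ≤ t)
    (hη : ∀ k, 1 ≤ k → 0 < η k) (hanti : AntitoneOn η (Set.Ici 1))
    (he : ∀ k, 1 ≤ k → k ≤ t → -B ≤ e k - c) (hB : 0 ≤ B)
    (hsum : ∀ s, 1 ≤ s → s ≤ t → ∑ k ∈ Finset.Icc s t, η k * (e k - e s)
      ≤ K * ∑ k ∈ Finset.Icc s t, η k ^ 2) :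
    e t - c ≤ (∑ k ∈ Finset.Icc 1 t, η k * (e k - c) - K * ∑ k ∈ Finset.Icc 1 t, η k ^ 2) / (η t * t)
      + K * (∑ k ∈ Finset.Ico 1 t, η k ^ 2 / (η t * ((t : ℝ) - k)) + η t)
      + B * ∑ k ∈ Finset.Ico 1 t, η k / (η t * ((t : ℝ) - k)) := by
  have hsuffix : ∀ (φ : ℕ → ℝ) m, m < t →
      ∑ r ∈ Finset.range (m + 1), φ (t - r) = ∑ k ∈ Finset.Icc (t - m) t, φ k := by
    intro φ m hm
    rw [Finset.range_eq_Ico, Finset.sum_Ico_reflect _ _ (by omega), ← Finset.Ico_succ_right_eq_Icc]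
    congr 2
    omega
  have hprefix : ∀ φ : ℕ → ℝ, ∑ r ∈ Finset.Ico 1 t, φ (t - r) = ∑ k ∈ Finset.Ico 1 t, φ k := by
    intro φ
    rw [Finset.sum_Ico_reflect _ _ (by omega)]
    congr 2
    omega
  -- Time is reversed by `r = t - k`, so non-increasing steps become non-decreasing weights. The
  -- shift by `c` cancels in the differences.
  have key := mul_zero_le_of_suffix_sums (a := fun r => η (t - r)) (u := fun r => e (t - r) - c)
    (K := K) (B := B) (N := t) (fun r hr => (hη _ (by omega)).le)
    (fun r m hrm hm => hanti (Set.mem_Ici.2 (by omega)) (Set.mem_Ici.2 (by omega)) (by omega))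
    (fun r hr => he _ (by omega) (by omega))
    (fun m hm => by
      rw [hsuffix (fun k => η k ^ 2) m hm,
        hsuffix (fun k => η k * (e k - c - (e (t - m) - c))) m hm]
      simpa using hsum (t - m) (by omega) (by omega)) hB ht le_rfl
  have hr : ∀ φ : ℕ → ℝ, ∑ r ∈ Finset.range t, φ (t - r) = ∑ k ∈ Finset.Icc 1 t, φ k := by
    intro φ
    have := hsuffix φ (t - 1) (by omega)
    rwa [Nat.sub_add_cancel ht, Nat.sub_sub_self ht] at this
  have hq : ∀ φ : ℕ → ℝ, ∑ r ∈ Finset.Ico 1 t, φ (t - r) / r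
      = ∑ k ∈ Finset.Ico 1 t, φ k / ((t : ℝ) - k) := by
    intro φ
    rw [← hprefix fun k => φ k / ((t : ℝ) - k)]
    refine Finset.sum_congr rfl fun r hr => ?_
    rw [Nat.cast_sub (Finset.mem_Ico.1 hr).2.le, sub_sub_cancel]
  rw [hr fun k => η k * (e k - c), hr fun k => η k ^ 2, hq fun k => η k ^ 2, hq η] at key
  simp only [Nat.sub_zero] at key
  have hηt := hη t ht
  have ht0 : (0 : ℝ) < t := by exact_mod_cast ht
  have hd : ∀ φ : ℕ → ℝ, ∑ k ∈ Finset.Ico 1 t, φ k / (η t * ((t : ℝ) - k))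
      = (∑ k ∈ Finset.Ico 1 t, φ k / ((t : ℝ) - k)) / η t := by
    intro φ
    rw [Finset.sum_div]
    exact Finset.sum_congr rfl fun k _ => by rw [mul_comm, div_mul_eq_div_div]
  rw [hd fun k => η k ^ 2, hd η]
  refine le_of_mul_le_mul_left (key.trans_eq ?_) hηt
  field_simp
  ring

end LastIterate

/-! ### Excess risk of the averaged and of the last iterate -/

section Abstract

variable {Z F : Type*} [MeasurableSpace Z] [NormedAddCommGroup F] [InnerProductSpace ℝ F]
  [MeasurableSpace F]

namespace NonexpansiveModel

variable {f : F → Z → ℝ} {g : F → Z → F} {G M : ℝ} {η : ℕ → ℝ}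

theorem sum_step_pos (h : NonexpansiveModel f g G M η) {t : ℕ} (ht : 1 ≤ t) :
    0 < ∑ k ∈ Finset.Icc 1 t, η k :=
  Finset.sum_pos (fun k hk => h.step_pos k (Finset.mem_Icc.1 hk).1) ⟨1, by simpa using ht⟩

theorem sum_Ico_le_sum_Icc (h : NonexpansiveModel f g G M η) {s t : ℕ} (hst : s ≤ t) :
    ∑ k ∈ Finset.Ico 1 s, η k ≤ ∑ k ∈ Finset.Icc 1 t, η k :=
  Finset.sum_le_sum_of_subset_of_nonneg
    (fun k hk => by rw [Finset.mem_Ico] at hk; rw [Finset.mem_Icc]; omega)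
    fun k hk _ => (h.step_pos k (Finset.mem_Icc.1 hk).1).le

theorem bddBelow_range_popRisk (h : NonexpansiveModel f g G M η) (ρ : Measure Z) :
    BddBelow (Set.range (popRisk f ρ)) := ⟨0, by rintro _ ⟨w, rfl⟩; exact h.popRisk_nonneg ρ w⟩

/-- Jensen's inequality for the empirical risk of the averaged iterate. -/
theorem sum_mul_empRisk_sgdAverage_le (h : NonexpansiveModel f g G M η) {n : ℕ} (S : Fin n → Z)
    (j : ℕ → Fin n) {t : ℕ} (ht : 1 ≤ t) :
    (∑ k ∈ Finset.Icc 1 t, η k) * empRisk f S (sgdAverage g η S j t)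
      ≤ ∑ k ∈ Finset.Icc 1 t, η k * empRisk f S (sgd g η S j k) := by
  have hΛ := h.sum_step_pos ht
  set w := sgdAverage g η S j t with hw
  -- The subgradient at the average serves for every `k`, so the linear terms of Jensen's inequality
  -- sum to zero.
  have hzero : ∑ k ∈ Finset.Icc 1 t, η k • (w - sgd g η S j k) = 0 := by
    simp only [smul_sub, Finset.sum_sub_distrib, ← Finset.sum_smul]
    rw [hw, sgdAverage, smul_inv_smul₀ hΛ.ne', sub_self]
  have hz : ∀ z, (∑ k ∈ Finset.Icc 1 t, η k) * f w z
      ≤ ∑ k ∈ Finset.Icc 1 t, η k * f (sgd g η S j k) z := by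
    intro z
    rw [← sub_nonpos, Finset.sum_mul, ← Finset.sum_sub_distrib]
    calc _ ≤ ∑ k ∈ Finset.Icc 1 t, ⟪g w z, η k • (w - sgd g η S j k)⟫_ℝ := by
          refine Finset.sum_le_sum fun k hk => ?_
          rw [← mul_sub, inner_smul_right]
          exact mul_le_mul_of_nonneg_left (h.subgradient _ _ z)
            (h.step_pos k (Finset.mem_Icc.1 hk).1).le
      _ = 0 := by rw [← inner_sum, hzero, inner_zero_right]
  unfold empRisk
  calc _ = (n : ℝ)⁻¹ * ∑ i, (∑ k ∈ Finset.Icc 1 t, η k) * f w (S i) := by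
        rw [← Finset.mul_sum]; ring
    _ ≤ (n : ℝ)⁻¹ * ∑ i, ∑ k ∈ Finset.Icc 1 t, η k * f (sgd g η S j k) (S i) := by
        gcongr with i; exact hz _
    _ = _ := by
        rw [Finset.sum_comm, Finset.mul_sum]
        refine Finset.sum_congr rfl fun k _ => ?_
        rw [← Finset.mul_sum]; ring

variable [BorelSpace F] [SecondCountableTopology F]

/-- Regret against the infimum of the risk, in terms of the approximation error. -/
theorem sum_meanEmpRisk_sub_iInf_le (h : NonexpansiveModel f g G M η) (ρ : Measure Z)
    [IsProbabilityMeasure ρ] (n : ℕ) [NeZero n] {t : ℕ} (ht : 1 ≤ t) :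
    ∑ k ∈ Finset.Icc 1 t, η k * (meanEmpRisk f g η ρ n k - ⨅ w, popRisk f ρ w)
      ≤ (∑ k ∈ Finset.Icc 1 t, η k)
          * ((⨅ w, (popRisk f ρ w + (1 / ∑ k ∈ Finset.Icc 1 t, η k) / 2 * ‖w‖ ^ 2))
            - ⨅ w, popRisk f ρ w)
        + G ^ 2 / 2 * ∑ k ∈ Finset.Icc 1 t, η k ^ 2 := by
  have hΛ := h.sum_step_pos ht
  set Λ := ∑ k ∈ Finset.Icc 1 t, η k with hΛdef
  have hsplit : ∀ c : ℝ, ∑ k ∈ Finset.Icc 1 t, η k * (meanEmpRisk f g η ρ n k - c)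
      = ∑ k ∈ Finset.Icc 1 t, η k * meanEmpRisk f g η ρ n k - Λ * c := by
    intro c
    simp only [mul_sub, Finset.sum_sub_distrib, ← Finset.sum_mul]
    rfl
  have hle : (∑ k ∈ Finset.Icc 1 t, η k * meanEmpRisk f g η ρ n k
        - G ^ 2 / 2 * ∑ k ∈ Finset.Icc 1 t, η k ^ 2) / Λ
      ≤ ⨅ w, (popRisk f ρ w + (1 / Λ) / 2 * ‖w‖ ^ 2) := by
    refine le_ciInf fun w => ?_
    have hr := h.sum_meanEmpRisk_sub_popRisk_le ρ n t w
    rw [hsplit] at hr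
    rw [div_le_iff₀ hΛ]
    have e : (popRisk f ρ w + (1 / Λ) / 2 * ‖w‖ ^ 2) * Λ = Λ * popRisk f ρ w + ‖w‖ ^ 2 / 2 := by
      field_simp
    rw [e]
    linarith
  rw [div_le_iff₀ hΛ] at hle
  rw [hsplit]
  linarith

theorem sum_mul_integral_empRisk_sgdAverage_le (h : NonexpansiveModel f g G M η) (ρ : Measure Z)
    [IsProbabilityMeasure ρ] (n : ℕ) [NeZero n] {t : ℕ} (ht : 1 ≤ t) :
    (∑ k ∈ Finset.Icc 1 t, η k)
        * ∫ ω, empRisk f ω.1 (sgdAverage g η ω.1 ω.2 t) ∂(sampleLaw ρ n)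
      ≤ ∑ k ∈ Finset.Icc 1 t, η k * meanEmpRisk f g η ρ n k := by
  have hi : ∀ k ∈ Finset.Icc 1 t, Integrable
      (fun ω : (Fin n → Z) × (ℕ → Fin n) => η k * empRisk f ω.1 (sgd g η ω.1 ω.2 k))
      (sampleLaw ρ n) := fun k hk =>
    (h.integrable_empRisk _ measurable_fst (h.measurable_sgd n k)
      fun ω => h.norm_sgd_le _ _ (Finset.mem_Icc.1 hk).1).const_mul _
  have hav := h.integrable_empRisk (sampleLaw ρ n) measurable_fst (h.measurable_sgdAverage n t)
    fun ω => h.norm_sgdAverage_le _ _ t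
  have := integral_mono (hav.const_mul (∑ k ∈ Finset.Icc 1 t, η k)) (integrable_finsetSum _ hi)
    fun ω => h.sum_mul_empRisk_sgdAverage_le ω.1 ω.2 ht
  rw [integral_const_mul, integral_finsetSum _ hi] at this
  simpa only [integral_const_mul, meanEmpRisk] using this

/-- Excess risk of the averaged iterate. -/
theorem integral_excess_sgdAverage_le (h : NonexpansiveModel f g G M η) (ρ : Measure Z)
    [IsProbabilityMeasure ρ] (n : ℕ) [NeZero n] {t : ℕ} (ht : 1 ≤ t) :
    ∫ ω, popRisk f ρ (sgdAverage g η ω.1 ω.2 t) ∂(sampleLaw ρ n) - ⨅ w, popRisk f ρ w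
      ≤ 2 * G ^ 2 * ((∑ k ∈ Finset.Icc 1 t, η k) / n)
        + G ^ 2 / 2 * ((∑ k ∈ Finset.Icc 1 t, η k ^ 2) / ∑ k ∈ Finset.Icc 1 t, η k)
        + ((⨅ w, (popRisk f ρ w + (1 / ∑ k ∈ Finset.Icc 1 t, η k) / 2 * ‖w‖ ^ 2))
            - ⨅ w, popRisk f ρ w) := by
  have hΛ := h.sum_step_pos ht
  have h1 := h.integral_popRisk_sgdAverage_le ρ n t
  have h2 := h.sum_mul_integral_empRisk_sgdAverage_le ρ n ht
  have h3 := h.sum_meanEmpRisk_sub_iInf_le ρ n ht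
  have h4 : 2 * G ^ 2 * (∑ k ∈ Finset.Ico 1 t, η k) / n
      ≤ 2 * G ^ 2 * ((∑ k ∈ Finset.Icc 1 t, η k) / n) := by
    rw [mul_div_assoc]
    gcongr 2 * G ^ 2 * (?_ / n)
    exact h.sum_Ico_le_sum_Icc le_rfl
  simp only [mul_sub, Finset.sum_sub_distrib, ← Finset.sum_mul] at h3
  set Λ := ∑ k ∈ Finset.Icc 1 t, η k
  set I := ∫ ω, empRisk f ω.1 (sgdAverage g η ω.1 ω.2 t) ∂(sampleLaw ρ n)
  set D := ⨅ w, (popRisk f ρ w + (1 / Λ) / 2 * ‖w‖ ^ 2)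
  have h5 : I ≤ G ^ 2 / 2 * ((∑ k ∈ Finset.Icc 1 t, η k ^ 2) / Λ) + D := by
    refine le_of_mul_le_mul_left ?_ hΛ
    have e : Λ * (G ^ 2 / 2 * ((∑ k ∈ Finset.Icc 1 t, η k ^ 2) / Λ) + D)
        = G ^ 2 / 2 * (∑ k ∈ Finset.Icc 1 t, η k ^ 2) + Λ * D := by field_simp
    rw [e]
    linarith
  linarith

/-- Excess risk of the last iterate. -/
theorem integral_excess_sgd_le (h : NonexpansiveModel f g G M η) (hanti : AntitoneOn η (Set.Ici 1))
    (ρ : Measure Z) [IsProbabilityMeasure ρ] (n : ℕ) [NeZero n] {t : ℕ} (ht : 1 ≤ t) :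
    ∫ ω, popRisk f ρ (sgd g η ω.1 ω.2 t) ∂(sampleLaw ρ n) - ⨅ w, popRisk f ρ w
      ≤ 4 * G ^ 2 * ((∑ k ∈ Finset.Icc 1 t, η k) / n
          * ∑ k ∈ Finset.Ico 1 t, η k / (η t * ((t : ℝ) - k)))
        + G ^ 2 / 2 * (∑ k ∈ Finset.Ico 1 t, η k ^ 2 / (η t * ((t : ℝ) - k)) + η t)
        + (∑ k ∈ Finset.Icc 1 t, η k)
          * ((⨅ w, (popRisk f ρ w + (1 / ∑ k ∈ Finset.Icc 1 t, η k) / 2 * ‖w‖ ^ 2))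
            - ⨅ w, popRisk f ρ w) / (η t * t) := by
  have hΛ := h.sum_step_pos ht
  have hn : (0 : ℝ) < n := Nat.cast_pos.2 (NeZero.pos n)
  have hηt := h.step_pos t ht
  have ht0 : (0 : ℝ) < t := by exact_mod_cast ht
  have hG : 0 ≤ 2 * G ^ 2 := by positivity
  have hterm : ∀ k ∈ Finset.Ico 1 t, 0 ≤ η k / (η t * ((t : ℝ) - k)) := by
    intro k hk
    rw [Finset.mem_Ico] at hk
    have : (k : ℝ) < t := by exact_mod_cast hk.2
    exact div_nonneg (h.step_pos k hk.1).le (mul_nonneg hηt.le (by linarith))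
  set H := ∑ k ∈ Finset.Ico 1 t, η k / (η t * ((t : ℝ) - k))
  -- The gap at time `t` lacks the factor `H`. For `t ≥ 2` the term `k = t - 1` gives `H ≥ 1`; for
  -- `t = 1` the gap sum is empty. Together with `hlow` this makes the constant `2 + 2 = 4`.
  have hgap : (∑ k ∈ Finset.Ico 1 t, η k) / n ≤ (∑ k ∈ Finset.Icc 1 t, η k) / n * H := by
    rcases ht.eq_or_lt with rfl | ht1
    · simp [H]
    · have hH : 1 ≤ H := by
        have hmem : t - 1 ∈ Finset.Ico 1 t := by rw [Finset.mem_Ico]; omega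
        refine le_trans ?_ (Finset.single_le_sum hterm hmem)
        rw [Nat.cast_sub ht, Nat.cast_one, sub_sub_cancel, mul_one, one_le_div hηt]
        exact hanti (Set.mem_Ici.2 (by omega)) (Set.mem_Ici.2 ht) (by omega)
      calc _ ≤ (∑ k ∈ Finset.Icc 1 t, η k) / n := by
            gcongr ?_ / n; exact h.sum_Ico_le_sum_Icc le_rfl
        _ ≤ _ := le_mul_of_one_le_right (by positivity) hH
  -- The true risk is never below its infimum, so the mean empirical risk can undercut that infimum
  -- by no more than the generalization gap.
  have hlow : ∀ k, 1 ≤ k → k ≤ t → -(2 * G ^ 2 * ((∑ k ∈ Finset.Icc 1 t, η k) / n))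
      ≤ meanEmpRisk f g η ρ n k - ⨅ w, popRisk f ρ w := by
    intro k hk hkt
    have h1 := h.integral_popRisk_sgd_le ρ n hk
    have h2 : ⨅ w, popRisk f ρ w
        ≤ ∫ ω, popRisk f ρ (sgd g η ω.1 ω.2 k) ∂(sampleLaw ρ n) := by
      have := integral_mono (integrable_const (⨅ w, popRisk f ρ w))
        (h.integrable_popRisk ρ (sampleLaw ρ n) (h.measurable_sgd n k)
          fun ω => h.norm_sgd_le _ _ hk)
        fun ω => ciInf_le (h.bddBelow_range_popRisk ρ) _
      simpa using this
    have h3 : 2 * G ^ 2 * (∑ l ∈ Finset.Ico 1 k, η l) / n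
        ≤ 2 * G ^ 2 * ((∑ k ∈ Finset.Icc 1 t, η k) / n) := by
      rw [mul_div_assoc]
      gcongr 2 * G ^ 2 * (?_ / n)
      exact h.sum_Ico_le_sum_Icc hkt
    linarith
  have hlast := last_le_of_suffix_sums (K := G ^ 2 / 2) ht h.step_pos hanti hlow (by positivity)
    fun s hs hst => h.sum_meanEmpRisk_sub_meanEmpRisk_le ρ n hs hst
  have hreg := h.sum_meanEmpRisk_sub_iInf_le ρ n ht
  -- The negative `∑ η k ^ 2` term in `hlast` cancels the one in the regret, leaving only the
  -- approximation error.
  have hreg' := div_le_div_of_nonneg_right (sub_le_iff_le_add.2 hreg)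
    (mul_pos hηt ht0).le
  have hpop := h.integral_popRisk_sgd_le ρ n ht
  have hgap' := mul_le_mul_of_nonneg_left hgap hG
  rw [mul_div_assoc] at hpop
  linarith

end NonexpansiveModel

end Abstract

/-! ### Smooth convex losses of one variable -/

section Loss

theorem leftDeriv_eq_deriv {φ : ℝ → ℝ} (hφ : Differentiable ℝ φ) (a : ℝ) :
    leftDeriv φ a = deriv φ a :=
  (hφ a).derivWithin (uniqueDiffWithinAt_Iio a)

theorem sub_le_leftDeriv_mul {φ : ℝ → ℝ} (hφ : Differentiable ℝ φ) (hc : ConvexOn ℝ Set.univ φ)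
    (a b : ℝ) : φ a - φ b ≤ leftDeriv φ a * (a - b) := by
  rw [leftDeriv_eq_deriv hφ]
  rcases lt_trichotomy a b with hab | rfl | hab
  · have := hc.deriv_le_slope (Set.mem_univ a) (Set.mem_univ b) hab (hφ a)
    rw [slope_def_field, le_div_iff₀ (sub_pos.2 hab)] at this
    linarith
  · simp
  · have := hc.slope_le_deriv (Set.mem_univ b) (Set.mem_univ a) hab (hφ a)
    rw [slope_def_field, div_le_iff₀ (sub_pos.2 hab)] at this
    linarith

theorem abs_sub_le_of_abs_leftDeriv_le {φ : ℝ → ℝ} (hφ : Differentiable ℝ φ) {a₀ : ℝ}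
    (hd : ∀ a, |leftDeriv φ a| ≤ a₀) (a b : ℝ) : |φ a - φ b| ≤ a₀ * |a - b| :=
  convex_univ.norm_image_sub_le_of_norm_deriv_le (fun x _ => hφ x)
    (fun x _ => by rw [← leftDeriv_eq_deriv hφ]; exact hd x) (Set.mem_univ b) (Set.mem_univ a)

/-- Cocoercivity of the derivative of a smooth convex function of one variable. -/
theorem sq_leftDeriv_sub_le {φ : ℝ → ℝ} (hφ : Differentiable ℝ φ) (hc : ConvexOn ℝ Set.univ φ)
    {L : ℝ} (hL : ∀ a b, |deriv φ b - deriv φ a| ≤ L * |b - a|) (a b : ℝ) :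
    (leftDeriv φ a - leftDeriv φ b) ^ 2 ≤ L * ((leftDeriv φ a - leftDeriv φ b) * (a - b)) := by
  have h1 := sub_le_leftDeriv_mul hφ hc a b
  have h2 := sub_le_leftDeriv_mul hφ hc b a
  -- Adding the two tangent inequalities shows that the derivative is monotone. On the line this and
  -- the Lipschitz bound already give cocoercivity.
  have h3 : 0 ≤ (leftDeriv φ a - leftDeriv φ b) * (a - b) := by linarith
  have h4 := hL b a
  rw [← leftDeriv_eq_deriv hφ, ← leftDeriv_eq_deriv hφ] at h4
  calc (leftDeriv φ a - leftDeriv φ b) ^ 2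
      = |leftDeriv φ a - leftDeriv φ b| * |leftDeriv φ a - leftDeriv φ b| := by
        rw [abs_mul_abs_self, sq]
    _ ≤ |leftDeriv φ a - leftDeriv φ b| * (L * |a - b|) :=
        mul_le_mul_of_nonneg_left h4 (abs_nonneg _)
    _ = L * |(leftDeriv φ a - leftDeriv φ b) * (a - b)| := by rw [abs_mul]; ring
    _ = _ := by rw [abs_of_nonneg h3]

/-- The derivative in the second variable of a jointly measurable function is measurable. -/
theorem measurable_uncurry_leftDeriv {Y : Type*} [MeasurableSpace Y] {ℓ : Y → ℝ → ℝ}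
    (hℓ : Measurable (Function.uncurry ℓ)) (hd : ∀ y, Differentiable ℝ (ℓ y)) :
    Measurable (Function.uncurry fun y => leftDeriv (ℓ y)) := by
  refine measurable_of_tendsto_metrizable (f := fun (m : ℕ) (p : Y × ℝ) =>
    (1 / ((m : ℝ) + 1))⁻¹ • (ℓ p.1 (p.2 + 1 / ((m : ℝ) + 1)) - ℓ p.1 p.2)) (fun m => ?_) ?_
  · have hshift : Measurable fun p : Y × ℝ => ℓ p.1 (p.2 + 1 / ((m : ℝ) + 1)) :=
      hℓ.comp (measurable_fst.prodMk (measurable_snd.add_const _))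
    exact (hshift.sub hℓ).const_mul _
  · rw [tendsto_pi_nhds]
    rintro ⟨y, a⟩
    simp only [Function.uncurry, leftDeriv_eq_deriv (hd y)]
    refine (hasDerivAt_iff_tendsto_slope_zero.1 (hd y a).hasDerivAt).comp ?_
    refine tendsto_nhdsWithin_iff.2 ⟨tendsto_one_div_add_atTop_nhds_zero_nat, ?_⟩
    exact Filter.Eventually.of_forall fun m => by
      simp only [Set.mem_compl_iff, Set.mem_singleton_iff]; positivity

end Loss

/-! ### Linear predictors as a nonexpansive model -/

section Model

variable {X : Type u} {Y : Type v} {F : Type w} [NormedAddCommGroup F] [InnerProductSpace ℝ F]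

/-- A gradient step of size `s` on a smooth convex loss of a linear predictor is nonexpansive. -/
theorem norm_gradient_step_sub_le {φ : ℝ → ℝ} (hφ : Differentiable ℝ φ)
    (hc : ConvexOn ℝ Set.univ φ) {L κ s : ℝ}
    (hL : ∀ a b, |deriv φ b - deriv φ a| ≤ L * |b - a|) (hs : 0 ≤ s) (hsL : s * (κ ^ 2 * L) ≤ 2)
    {x : F} (hx : ‖x‖ ≤ κ) (w v : F) :
    ‖(w - s • leftDeriv φ ⟪w, x⟫_ℝ • x) - (v - s • leftDeriv φ ⟪v, x⟫_ℝ • x)‖ ≤ ‖w - v‖ := by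
  set p := leftDeriv φ ⟪w, x⟫_ℝ - leftDeriv φ ⟪v, x⟫_ℝ with hp
  have e : (w - s • leftDeriv φ ⟪w, x⟫_ℝ • x) - (v - s • leftDeriv φ ⟪v, x⟫_ℝ • x)
      = (w - v) - (s * p) • x := by
    rw [hp]; module
  rw [e]
  refine le_of_sq_le_sq ?_ (norm_nonneg _)
  rw [norm_sub_sq_real, inner_smul_right, norm_smul, mul_pow, Real.norm_eq_abs, sq_abs,
    inner_sub_left]
  have h1 := sq_leftDeriv_sub_le hφ hc hL ⟪w, x⟫_ℝ ⟪v, x⟫_ℝ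
  have h2 := sub_le_leftDeriv_mul hφ hc ⟪w, x⟫_ℝ ⟪v, x⟫_ℝ
  have h3 := sub_le_leftDeriv_mul hφ hc ⟪v, x⟫_ℝ ⟪w, x⟫_ℝ
  rw [← hp] at h1
  set q := ⟪w, x⟫_ℝ - ⟪v, x⟫_ℝ
  have hpq : 0 ≤ p * q := by rw [hp]; linarith
  have hx2 : ‖x‖ ^ 2 ≤ κ ^ 2 := pow_le_pow_left₀ (norm_nonneg _) hx 2
  -- Cocoercivity bounds `p ^ 2` by `L * (p * q)`; the step-size condition then makes the quadratic
  -- term at most the cross term of the expanded square.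
  have h4 : (s * p) ^ 2 * ‖x‖ ^ 2 ≤ 2 * (s * p * q) :=
    calc (s * p) ^ 2 * ‖x‖ ^ 2 ≤ (s * p) ^ 2 * κ ^ 2 := by gcongr
      _ = s ^ 2 * κ ^ 2 * p ^ 2 := by ring
      _ ≤ s ^ 2 * κ ^ 2 * (L * (p * q)) := by gcongr
      _ = s * (κ ^ 2 * L) * (s * (p * q)) := by ring
      _ ≤ 2 * (s * (p * q)) := by gcongr
      _ = _ := by ring
  linarith

theorem nonexpansiveModel_linear [MeasurableSpace X] [MeasurableSpace Y]
    [SecondCountableTopology F] [MeasurableSpace F] [BorelSpace F]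
    {Φ : X → F} {ℓ : Y → ℝ → ℝ} {L κ a₀ M : ℝ} {η : ℕ → ℝ} (hΦ : Measurable Φ)
    (hℓ : Measurable (Function.uncurry ℓ)) (hnn : ∀ y a, 0 ≤ ℓ y a)
    (hconv : ∀ y, ConvexOn ℝ Set.univ (ℓ y)) (hκ0 : 0 ≤ κ) (hκ : ∀ x, ‖Φ x‖ ≤ κ)
    (hM : ∀ y, ℓ y 0 ≤ M) (ha0 : 0 ≤ a₀) (ha : ∀ y a, |leftDeriv (ℓ y) a| ≤ a₀)
    (hd : ∀ y, Differentiable ℝ (ℓ y))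
    (hL : ∀ y a b, |deriv (ℓ y) b - deriv (ℓ y) a| ≤ L * |b - a|)
    (hη : ∀ t, 1 ≤ t → 0 < η t) (hηL : ∀ t, 1 ≤ t → η t * (κ ^ 2 * L) ≤ 2) :
    NonexpansiveModel (fun (w : F) (z : X × Y) => ℓ z.2 ⟪w, Φ z.1⟫_ℝ)
      (fun w z => leftDeriv (ℓ z.2) ⟪w, Φ z.1⟫_ℝ • Φ z.1) (a₀ * κ) M η := by
  have hmΦ : Measurable fun p : F × (X × Y) => Φ p.2.1 :=
    hΦ.comp (measurable_fst.comp measurable_snd)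
  have hm : Measurable fun p : F × (X × Y) => (p.2.2, ⟪p.1, Φ p.2.1⟫_ℝ) :=
    (measurable_snd.comp measurable_snd).prodMk (measurable_fst.inner hmΦ)
  refine ⟨hℓ.comp hm, ?_, mul_nonneg ha0 hκ0, fun w v z => ?_, fun w v z => ?_, fun w z => ?_,
    fun k hk w v z => ?_, fun w z => hnn _ _, fun z => by simpa using hM z.2, hη⟩
  · exact ((measurable_uncurry_leftDeriv hℓ hd).comp hm).smul hmΦ
  · refine (abs_sub_le_of_abs_leftDeriv_le (hd z.2) (ha z.2) _ _).trans ?_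
    rw [← inner_sub_left, mul_assoc]
    refine mul_le_mul_of_nonneg_left ((abs_real_inner_le_norm _ _).trans ?_) ha0
    rw [mul_comm]
    exact mul_le_mul_of_nonneg_right (hκ z.1) (norm_nonneg _)
  · refine (sub_le_leftDeriv_mul (hd z.2) (hconv z.2) _ _).trans_eq ?_
    rw [← inner_sub_left, real_inner_smul_left, real_inner_comm (Φ z.1) (w - v)]
  · rw [norm_smul, Real.norm_eq_abs]
    exact mul_le_mul (ha _ _) (hκ _) (norm_nonneg _) ha0
  · exact norm_gradient_step_sub_le (hd z.2) (hconv z.2) (hL z.2) (hη k hk).le (hηL k hk)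
      (hκ z.1) w v

theorem iterate_eq_sgd (ℓ : Y → ℝ → ℝ) (Φ : X → F) (η : ℕ → ℝ) {n : ℕ} (S : Fin n → X × Y)
    (j : ℕ → Fin n) (t : ℕ) :
    iterate ℓ Φ η S j t
      = sgd (fun w (z : X × Y) => leftDeriv (ℓ z.2) ⟪w, Φ z.1⟫_ℝ • Φ z.1) η S j t := by
  rcases Nat.eq_zero_or_pos t with rfl | ht
  · rfl
  induction t, ht using Nat.le_induction with
  | base => rfl
  | succ t ht ih =>
    obtain ⟨s, rfl⟩ := Nat.exists_eq_add_of_le' ht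
    rw [sgd_succ _ _ _ _ ht, ← ih, iterate, mul_smul]

end Model

end SGM

theorem mainTheorem8 (κ a₀ c : ℝ) :
    ∃ C : ℝ, 0 < C ∧
      ∀ (X : Type u) (Y : Type v) (F : Type w)
        [MeasurableSpace X] [MeasurableSpace Y]
        [NormedAddCommGroup F] [InnerProductSpace ℝ F] [CompleteSpace F]
        [TopologicalSpace.SeparableSpace F] [MeasurableSpace F] [BorelSpace F]
        (ρ : Measure (X × Y)) [IsProbabilityMeasure ρ]
        (Φ : X → F) (ℓ : Y → ℝ → ℝ) (L β : ℝ) (η : ℕ → ℝ),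
        Measurable Φ →
        -- the loss: measurable, nonnegative, convex in its second entry
        Measurable (Function.uncurry ℓ) →
        (∀ y a, 0 ≤ ℓ y a) →
        (∀ y, ConvexOn ℝ Set.univ (ℓ y)) →
        -- bounded features, bounded loss at zero, bounded left-hand derivative
        IsLUB (Set.range fun x => Real.sqrt ⟪Φ x, Φ x⟫_ℝ) κ →
        BddAbove (Set.range fun y => ℓ y 0) →
        (∀ y a, |SGM.leftDeriv (ℓ y) a| ≤ a₀) →
        -- decay of the approximation error
        0 < β → β ≤ 1 → 0 < c →
        (∀ lam : ℝ, 0 < lam → SGM.approxError ρ ℓ Φ lam ≤ c * lam ^ β) →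
        -- smoothness of the loss
        0 < L →
        (∀ y, Differentiable ℝ (ℓ y)) →
        (∀ y a b, |deriv (ℓ y) b - deriv (ℓ y) a| ≤ L * |b - a|) →
        -- positive, non-increasing step-sizes with `η_t ≤ 2 / (κ² L)`
        (∀ t, 1 ≤ t → 0 < η t) →
        AntitoneOn η (Set.Ici 1) →
        (∀ t, 1 ≤ t → η t * (κ ^ 2 * L) ≤ 2) →
        ∀ (n : ℕ) [NeZero n] (t : ℕ), 1 ≤ t →
          (Integrable (fun ω => SGM.risk ρ ℓ Φ (SGM.average ℓ Φ η ω.1 ω.2 t)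
              - ⨅ w : F, SGM.risk ρ ℓ Φ w) (SGM.law ρ n) ∧
            ∫ ω, (SGM.risk ρ ℓ Φ (SGM.average ℓ Φ η ω.1 ω.2 t)
                - ⨅ w : F, SGM.risk ρ ℓ Φ w) ∂(SGM.law ρ n) ≤
              C * ((∑ k ∈ Finset.Icc 1 t, η k) / n
                + (∑ k ∈ Finset.Icc 1 t, η k ^ 2) / (∑ k ∈ Finset.Icc 1 t, η k)
                + (1 / ∑ k ∈ Finset.Icc 1 t, η k) ^ β)) ∧
          (Integrable (fun ω => SGM.risk ρ ℓ Φ (SGM.iterate ℓ Φ η ω.1 ω.2 t)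
              - ⨅ w : F, SGM.risk ρ ℓ Φ w) (SGM.law ρ n) ∧
            ∫ ω, (SGM.risk ρ ℓ Φ (SGM.iterate ℓ Φ η ω.1 ω.2 t)
                - ⨅ w : F, SGM.risk ρ ℓ Φ w) ∂(SGM.law ρ n) ≤
              C * ((∑ k ∈ Finset.Icc 1 t, η k) / n
                    * (∑ k ∈ Finset.Ico 1 t, η k / (η t * ((t : ℝ) - k)))
                + ((∑ k ∈ Finset.Ico 1 t, η k ^ 2 / (η t * ((t : ℝ) - k))) + η t)
                + (∑ k ∈ Finset.Icc 1 t, η k) ^ (1 - β) / (η t * t))) := by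
  -- The factor `5` exceeds the coefficients `2`, `4` and `1 / 2` of the two bounds, and `|c|`
  -- covers the approximation error. The sign of `c` is not yet known here, hence the absolute
  -- value; the `1` ensures positivity.
  refine ⟨5 * (a₀ * κ) ^ 2 + |c| + 1, by positivity, ?_⟩
  intro X Y F _ _ _ _ _ _ _ _ ρ _ Φ ℓ L β η hΦ hℓ hnn hconv hκ hbdd ha hβ0 hβ1 hc happ hL0 hd hL
    hη hanti hηL n _ t ht
  have : SecondCountableTopology F := UniformSpace.secondCountable_of_separable F
  -- A probability measure has a nonempty space; a point is needed to see that `κ` and `a₀` are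
  -- nonnegative.
  obtain ⟨⟨x₀, y₀⟩⟩ : Nonempty (X × Y) := ρ.nonempty_of_neZero
  obtain ⟨M, hM⟩ := hbdd
  have hκ' : ∀ x, ‖Φ x‖ ≤ κ := fun x => by
    rw [norm_eq_sqrt_real_inner]; exact hκ.1 ⟨x, rfl⟩
  have hκ0 : 0 ≤ κ := (norm_nonneg _).trans (hκ' x₀)
  have ha0 : 0 ≤ a₀ := (abs_nonneg _).trans (ha y₀ 0)
  have h := SGM.nonexpansiveModel_linear hΦ hℓ hnn hconv hκ0 hκ' (fun y => hM ⟨y, rfl⟩) ha0 ha hd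
    hL hη hηL
  set f := fun (w : F) (z : X × Y) => ℓ z.2 ⟪w, Φ z.1⟫_ℝ
  set g := fun (w : F) (z : X × Y) => SGM.leftDeriv (ℓ z.2) ⟪w, Φ z.1⟫_ℝ • Φ z.1
  have hrisk : SGM.risk ρ ℓ Φ = SGM.popRisk f ρ := rfl
  have hlaw : SGM.law ρ n = SGM.sampleLaw ρ n := rfl
  have hit : ∀ (S : Fin n → X × Y) j, SGM.iterate ℓ Φ η S j = SGM.sgd g η S j := fun S j =>
    funext fun k => SGM.iterate_eq_sgd ℓ Φ η S j k
  have hav : ∀ (S : Fin n → X × Y) j, SGM.average ℓ Φ η S j t = SGM.sgdAverage g η S j t :=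
    fun S j => by rw [SGM.average, SGM.sgdAverage, hit]
  have hΛ := h.sum_step_pos ht
  have hA := happ (1 / ∑ k ∈ Finset.Icc 1 t, η k) (by positivity)
  rw [SGM.approxError] at hA
  simp only [hrisk, hlaw, hit, hav] at hA ⊢
  have b1 := h.integral_excess_sgdAverage_le ρ n ht
  have b2 := h.integral_excess_sgd_le hanti ρ n ht
  have i1 := h.integrable_popRisk ρ (SGM.sampleLaw ρ n) (h.measurable_sgdAverage n t)
    fun ω => h.norm_sgdAverage_le _ _ t
  have i2 := h.integrable_popRisk ρ (SGM.sampleLaw ρ n) (h.measurable_sgd n t)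
    fun ω => h.norm_sgd_le _ _ ht
  have hηt := hη t ht
  have ht0 : (0 : ℝ) < t := by exact_mod_cast ht
  have hq : 0 ≤ (a₀ * κ) ^ 2 := sq_nonneg _
  have hc' : c = |c| := (abs_of_pos hc).symm
  have hsub : ∀ k ∈ Finset.Ico 1 t, 0 < η t * ((t : ℝ) - k) := fun k hk => by
    have : (k : ℝ) < t := by exact_mod_cast (Finset.mem_Ico.1 hk).2
    exact mul_pos hηt (by linarith)
  refine ⟨⟨i1.sub (integrable_const _), ?_⟩, ⟨i2.sub (integrable_const _), ?_⟩⟩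
  · rw [integral_sub i1 (integrable_const _)]
    simp only [integral_const, probReal_univ, one_smul]
    refine (b1.trans (add_le_add le_rfl hA)).trans ?_
    have p1 : 0 ≤ (∑ k ∈ Finset.Icc 1 t, η k) / n := by positivity
    have p2 : 0 ≤ (∑ k ∈ Finset.Icc 1 t, η k ^ 2) / ∑ k ∈ Finset.Icc 1 t, η k :=
      div_nonneg (Finset.sum_nonneg fun k _ => sq_nonneg _) hΛ.le
    have p3 : 0 ≤ (1 / ∑ k ∈ Finset.Icc 1 t, η k) ^ β := by positivity
    rw [mul_add, mul_add]
    gcongr ?_ * _ + ?_ * _ + ?_ * _ <;> linarith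
  · rw [integral_sub i2 (integrable_const _)]
    simp only [integral_const, probReal_univ, one_smul]
    have hpow : (∑ k ∈ Finset.Icc 1 t, η k) * (c * (1 / ∑ k ∈ Finset.Icc 1 t, η k) ^ β)
        = c * (∑ k ∈ Finset.Icc 1 t, η k) ^ (1 - β) := by
      rw [one_div, Real.inv_rpow hΛ.le, Real.rpow_sub hΛ, Real.rpow_one]
      ring
    have hA' := div_le_div_of_nonneg_right (mul_le_mul_of_nonneg_left hA hΛ.le)
      (mul_pos hηt ht0).le
    rw [hpow, mul_div_assoc c] at hA'
    refine (b2.trans (add_le_add le_rfl hA')).trans ?_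
    have p1 : 0 ≤ (∑ k ∈ Finset.Icc 1 t, η k) / n
        * ∑ k ∈ Finset.Ico 1 t, η k / (η t * ((t : ℝ) - k)) :=
      mul_nonneg (by positivity) (Finset.sum_nonneg fun k hk =>
        div_nonneg (hη k (Finset.mem_Ico.1 hk).1).le (hsub k hk).le)
    have p2 : 0 ≤ ∑ k ∈ Finset.Ico 1 t, η k ^ 2 / (η t * ((t : ℝ) - k)) + η t :=
      add_nonneg (Finset.sum_nonneg fun k hk => div_nonneg (sq_nonneg _) (hsub k hk).le) hηt.le
    have p3 : 0 ≤ (∑ k ∈ Finset.Icc 1 t, η k) ^ (1 - β) / (η t * t) := by positivity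
    rw [mul_add (5 * (a₀ * κ) ^ 2 + |c| + 1), mul_add (5 * (a₀ * κ) ^ 2 + |c| + 1)]
    gcongr ?_ * _ + ?_ * _ + ?_ * _ <;> linarith
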